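/- Let $(X,d)$ be a metric space of bounded geometry, i.e. for every $R>0$ the cardinalities of the closed balls of radius $R$ are uniformly bounded. For a bounded operator $T$ on $\ell^2(X)$ write $T(x,y)=\langle T\delta_y,\delta_x\rangle$. The uniform Roe algebra $C^*_u(X)$ is the norm closure of the operators of finite propagation, i.e. of those $T$ for which there is $R$ with $T(x,y)=0$ whenever $d(x,y)>R$. Let $\beta X$ be the Stone–Čech compactification of the set $X$ and let $G(X)=\bigcup_{R>0}\overline{\{(x,y):d(x,y)\le R\}}\subseteq\beta(X\times X)$ be the coarse groupoid, a locally compact Hausdorff étale groupoid with unit space $\beta X$, whose range and source maps $\mathrm r,\mathrm s$ extend the two coordinate projections and whose arrows are determined by range and source. For a locally compact Hausdorff étale groupoid $\mathcal G$, $C^*_r(\mathcal G)$ denotes the completion of the convolution $*$-algebra $C_c(\mathcal G)$ in the reduced norm $\sup_x\|\lambda_x(f)\|$, where $\lambda_x$ are the left regular representations on $\ell^2(\mathrm s^{-1}(x))$. Let $U\subseteq\beta X$ be open and invariant ($\mathrm r^{-1}(U)=\mathrm s^{-1}(U)$), let $U^c=\beta X\setminus U$, and write $G(X)_Y=\mathrm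 s^{-1}(Y)$ for $Y=U,U^c$. Extension by zero $C_c(G(X)_U)\to C_c(G(X))$ and restriction $C_c(G(X))\to C_c(G(X)_{U^c})$ extend to $*$-homomorphisms $$C^*_r(G(X)_U)\xrightarrow{\ i_U\ }C^*_r(G(X))\xrightarrow{\ q_U\ }C^*_r(G(X)_{U^c}).$$ Let the geometric ideal $I(U)\subseteq C^*_u(X)$ be the closure of the set of all operators with matrix $(f(x,y))_{x,y\in X}$, where $f\in C_c(G(X))$ vanishes outside $G(X)_U$, and let the ghostly ideal be $$\tilde I(U)=\{T\in C^*_u(X):\ \overline{\{x\in X:\exists y\in X,\ |T(x,y)|\ge\varepsilon\}}^{\,\beta X}\subseteq U\ \text{ for all }\varepsilon>0\}.$$ Then there is a unique $*$-isomorphism $\Theta:C^*_r(G(X))\to C^*_u(X)$ that sends every $f\in C_c(G(X))$ to the operator with matrix $(f(x,y))_{x,y\in X}$, and under this identification $$\Theta(\ker q_U)=\tilde I(U).$$ Moreover, the sequence $0\to C^*_r(G(X)_U)\xrightarrow{i_U}C^*_r(G(X))\xrightarrow{q_U}C^*_r(G(X)_{U^c})\to0$ is exact if and only if $I(U)=\tilde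 I(U)$. -/

import Mathlib

open scoped CompactlySupported InnerProductSpace

noncomputable section

namespace CoarseIdeals

/-! ### Operators on the Hilbert space of square-summable functions -/

/-- The Hilbert space of square-summable complex functions on a set. -/
abbrev Ell2 (ι : Type*) : Type _ := lp (fun _ : ι => ℂ) 2

/-- Bounded operators on `Ell2 ι`. -/
abbrev BOp (ι : Type*) : Type _ := Ell2 ι →L[ℂ] Ell2 ι

open scoped Classical in
/-- The standard basis vector at `i`. -/
def delta {ι : Type*} (i : ι) : Ell2 ι := lp.single 2 i (1 : ℂ)

/-- The matrix coefficient `T(x, y)`, the value at `x` of the image of the basis vector at `y`. -/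
def coeff {ι κ : Type*} (T : Ell2 ι →L[ℂ] Ell2 κ) (x : κ) (y : ι) : ℂ := (T (delta y) : κ → ℂ) x

open scoped Classical in
theorem delta_apply {ι : Type*} (i j : ι) :
    (delta i : ι → ℂ) j = if j = i then 1 else 0 := by
  simp [delta, Pi.single_apply]

theorem inner_delta {ι : Type*} (i : ι) (ξ : Ell2 ι) : ⟪delta i, ξ⟫_ℂ = (ξ : ι → ℂ) i := by
  simp [delta, lp.inner_single_left]

theorem op_ext {ι κ : Type*} {T S : Ell2 ι →L[ℂ] Ell2 κ}
    (h : ∀ x y, coeff T x y = coeff S x y) : T = S := by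
  classical
  refine lp.ext_continuousLinearMap (by norm_num) fun i => ?_
  ext
  rename_i x
  have := h x i
  simpa [coeff, delta] using this

theorem coeff_adjoint {ι κ : Type*} (T : Ell2 ι →L[ℂ] Ell2 κ) (x : ι) (y : κ) :
    coeff (ContinuousLinearMap.adjoint T) x y = starRingEnd ℂ (coeff T y x) := by
  unfold coeff
  rw [← inner_delta, ContinuousLinearMap.adjoint_inner_right, ← inner_delta y, inner_conj_symm]

theorem coeff_star {ι : Type*} (T : BOp ι) (x y : ι) :
    coeff (star T) x y = starRingEnd ℂ (coeff T y x) := coeff_adjoint T x y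

theorem coeff_add {ι κ : Type*} (T S : Ell2 ι →L[ℂ] Ell2 κ) (x : κ) (y : ι) :
    coeff (T + S) x y = coeff T x y + coeff S x y := rfl

theorem coeff_smul {ι κ : Type*} (c : ℂ) (T : Ell2 ι →L[ℂ] Ell2 κ) (x : κ) (y : ι) :
    coeff (c • T) x y = c * coeff T x y := rfl

theorem coeff_zero {ι κ : Type*} (x : κ) (y : ι) :
    coeff (0 : Ell2 ι →L[ℂ] Ell2 κ) x y = 0 := rfl

theorem coeff_one_of_ne {ι : Type*} {x y : ι} (h : x ≠ y) : coeff (1 : BOp ι) x y = 0 := by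
  simp [coeff, delta_apply, h]

theorem hasSum_op {ι κ : Type*} (T : Ell2 ι →L[ℂ] Ell2 κ) (ξ : Ell2 ι) (x : κ) :
    HasSum (fun y => coeff T x y * (ξ : ι → ℂ) y) ((T ξ : κ → ℂ) x) := by
  classical
  have h := (lp.hasSum_single (p := 2) (by norm_num) ξ).mapL
    ((innerSL ℂ (delta x)).comp T)
  have e : ∀ y, (lp.single 2 y ((ξ : ι → ℂ) y) : Ell2 ι) = (ξ : ι → ℂ) y • delta y := by
    intro y
    rw [delta, ← lp.single_smul]
    simp
  simp only [ContinuousLinearMap.comp_apply, innerSL_apply_apply, inner_delta, e, map_smul] at h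
  simpa [coeff, mul_comm] using h

theorem hasSum_coeff_mul {ι κ μ : Type*} (T : Ell2 κ →L[ℂ] Ell2 μ) (S : Ell2 ι →L[ℂ] Ell2 κ)
    (x : μ) (z : ι) : HasSum (fun y => coeff T x y * coeff S y z) (coeff (T.comp S) x z) :=
  hasSum_op T (S (delta z)) x

/-- A kernel with uniformly bounded entries and uniformly finitely supported rows and columns. -/
structure IsBandKernel {ι : Type*} (k : ι → ι → ℂ) (N : ℕ) (M : ℝ) : Prop where
  nonneg : 0 ≤ M
  row : ∀ x, {y | k x y ≠ 0}.encard ≤ N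
  col : ∀ y, {x | k x y ≠ 0}.encard ≤ N
  bound : ∀ x y, ‖k x y‖ ≤ M

namespace IsBandKernel

variable {ι : Type*} {k : ι → ι → ℂ} {N : ℕ} {M : ℝ}

theorem finite_row (hk : IsBandKernel k N M) (x : ι) : {y | k x y ≠ 0}.Finite :=
  Set.finite_of_encard_le_coe (hk.row x)

theorem tsum_eq (hk : IsBandKernel k N M) (ξ : ι → ℂ) (x : ι) :
    ∑' y, k x y * ξ y = ∑ y ∈ (hk.finite_row x).toFinset, k x y * ξ y := by
  refine tsum_eq_sum fun y hy => ?_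
  simp at hy
  simp [hy]

theorem sum_le (hk : IsBandKernel k N M) (ξ : Ell2 ι) (s : Finset ι) :
    ∑ x ∈ s, ‖∑' y, k x y * (ξ : ι → ℂ) y‖ ^ (2 : ℝ) ≤ (N * M * ‖ξ‖) ^ (2 : ℝ) := by
  classical
  have h1 : ∀ x, ‖∑' y, k x y * (ξ : ι → ℂ) y‖ ^ 2 ≤
      N * M ^ 2 * ∑ y ∈ (hk.finite_row x).toFinset, ‖(ξ : ι → ℂ) y‖ ^ 2 := by
    intro x
    rw [hk.tsum_eq]
    set S := (hk.finite_row x).toFinset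
    have hS : (S.card : ℝ) ≤ N := by
      have := hk.row x
      rw [(hk.finite_row x).encard_eq_coe_toFinset_card] at this
      exact_mod_cast this
    have a1 : ‖∑ y ∈ S, k x y * (ξ : ι → ℂ) y‖ ≤ M * ∑ y ∈ S, ‖(ξ : ι → ℂ) y‖ := by
      refine (norm_sum_le _ _).trans ?_
      rw [Finset.mul_sum]
      refine Finset.sum_le_sum fun y _ => ?_
      rw [norm_mul]
      exact mul_le_mul_of_nonneg_right (hk.bound x y) (norm_nonneg _)
    calc ‖∑ y ∈ S, k x y * (ξ : ι → ℂ) y‖ ^ 2 ≤ (M * ∑ y ∈ S, ‖(ξ : ι → ℂ) y‖) ^ 2 := by gcongr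
      _ = M ^ 2 * (∑ y ∈ S, ‖(ξ : ι → ℂ) y‖) ^ 2 := by ring
      _ ≤ M ^ 2 * (S.card * ∑ y ∈ S, ‖(ξ : ι → ℂ) y‖ ^ 2) := by
          gcongr; exact sq_sum_le_card_mul_sum_sq
      _ ≤ M ^ 2 * (N * ∑ y ∈ S, ‖(ξ : ι → ℂ) y‖ ^ 2) := by gcongr
      _ = _ := by ring
  have h2 : ∑ x ∈ s, ∑ y ∈ (hk.finite_row x).toFinset, ‖(ξ : ι → ℂ) y‖ ^ 2 ≤ N * ‖ξ‖ ^ 2 := by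
    set T : Finset ι := s.biUnion fun x => (hk.finite_row x).toFinset
    have a1 : ∑ x ∈ s, ∑ y ∈ (hk.finite_row x).toFinset, ‖(ξ : ι → ℂ) y‖ ^ 2 =
        ∑ y ∈ T, ∑ x ∈ s with k x y ≠ 0, ‖(ξ : ι → ℂ) y‖ ^ 2 := by
      refine Finset.sum_comm' fun x y => ?_
      simp [T]
      grind
    rw [a1]
    have a2 : ∑ y ∈ T, ‖(ξ : ι → ℂ) y‖ ^ 2 ≤ ‖ξ‖ ^ 2 := by
      have := lp.sum_rpow_le_norm_rpow (p := 2) (by norm_num) ξ T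
      simpa using this
    calc _ ≤ ∑ y ∈ T, N * ‖(ξ : ι → ℂ) y‖ ^ 2 := by
          refine Finset.sum_le_sum fun y _ => ?_
          rw [Finset.sum_const, nsmul_eq_mul]
          gcongr
          have : ((s.filter fun x => k x y ≠ 0 : Finset ι) : Set ι).encard ≤ N :=
            (Set.encard_le_encard (by intro x; simp)).trans (hk.col y)
          rw [Set.encard_coe_eq_coe_finsetCard] at this
          exact_mod_cast this
      _ = N * ∑ y ∈ T, ‖(ξ : ι → ℂ) y‖ ^ 2 := by rw [Finset.mul_sum]
      _ ≤ _ := by gcongr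
  simp only [Real.rpow_ofNat]
  calc _ ≤ ∑ x ∈ s, N * M ^ 2 * ∑ y ∈ (hk.finite_row x).toFinset, ‖(ξ : ι → ℂ) y‖ ^ 2 :=
        Finset.sum_le_sum fun x _ => h1 x
    _ = N * M ^ 2 * ∑ x ∈ s, ∑ y ∈ (hk.finite_row x).toFinset, ‖(ξ : ι → ℂ) y‖ ^ 2 := by
        rw [Finset.mul_sum]
    _ ≤ N * M ^ 2 * (N * ‖ξ‖ ^ 2) := by gcongr
    _ = _ := by ring

/-- The bounded operator whose matrix is a given band kernel. -/
def op (hk : IsBandKernel k N M) : BOp ι :=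
  LinearMap.mkContinuous
    { toFun := fun ξ => ⟨fun x => ∑' y, k x y * (ξ : ι → ℂ) y,
        memℓp_gen' (C := (N * M * ‖ξ‖) ^ (2 : ℝ)) fun s => by simpa using hk.sum_le ξ s⟩
      map_add' := fun ξ η => by
        ext x
        change ∑' y, k x y * (((ξ + η : Ell2 ι)) : ι → ℂ) y =
          ∑' y, k x y * (ξ : ι → ℂ) y + ∑' y, k x y * (η : ι → ℂ) y
        rw [hk.tsum_eq, hk.tsum_eq, hk.tsum_eq, ← Finset.sum_add_distrib]
        simp [mul_add]
      map_smul' := fun c ξ => by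
        ext x
        change ∑' y, k x y * (((c • ξ : Ell2 ι)) : ι → ℂ) y = c * ∑' y, k x y * (ξ : ι → ℂ) y
        rw [hk.tsum_eq, hk.tsum_eq, Finset.mul_sum]
        simp [mul_left_comm] }
    (N * M)
    fun ξ => lp.norm_le_of_forall_sum_le (by norm_num)
      (mul_nonneg (mul_nonneg (Nat.cast_nonneg _) hk.nonneg) (norm_nonneg _))
      fun s => by simpa using hk.sum_le ξ s

theorem op_apply (hk : IsBandKernel k N M) (ξ : Ell2 ι) (x : ι) :
    (hk.op ξ : ι → ℂ) x = ∑' y, k x y * (ξ : ι → ℂ) y := rfl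

theorem coeff_op (hk : IsBandKernel k N M) (x y : ι) : coeff hk.op x y = k x y := by
  classical
  rw [coeff, op_apply, tsum_eq_single y]
  · simp [delta_apply]
  · intro z hz
    simp [delta_apply, hz]

end IsBandKernel

/-- Restriction of square-summable functions to a subset. -/
def restrict {ι : Type*} (p : ι → Prop) : Ell2 ι →L[ℂ] Ell2 (Subtype p) :=
  have key : ∀ (ξ : Ell2 ι) (s : Finset (Subtype p)),
      ∑ i ∈ s, ‖(ξ : ι → ℂ) i‖ ^ ENNReal.toReal 2 ≤ ‖ξ‖ ^ ENNReal.toReal 2 := fun ξ s => by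
    have := lp.sum_rpow_le_norm_rpow (p := 2) (by norm_num) ξ (s.map (Function.Embedding.subtype p))
    rwa [Finset.sum_map] at this
  LinearMap.mkContinuous
    { toFun := fun ξ => ⟨fun i => (ξ : ι → ℂ) i, memℓp_gen' (key ξ)⟩
      map_add' := fun _ _ => rfl
      map_smul' := fun _ _ => rfl }
    1
    fun ξ => by
      rw [one_mul]
      exact lp.norm_le_of_forall_sum_le (by norm_num) (norm_nonneg _) (key ξ)

/-- Extension of square-summable functions by zero, the adjoint of restriction. -/
def extendZero {ι : Type*} (p : ι → Prop) : Ell2 (Subtype p) →L[ℂ] Ell2 ι :=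
  ContinuousLinearMap.adjoint (restrict p)

theorem restrict_apply {ι : Type*} (p : ι → Prop) (ξ : Ell2 ι) (i : Subtype p) :
    (restrict p ξ : Subtype p → ℂ) i = (ξ : ι → ℂ) i := rfl

theorem restrict_delta {ι : Type*} (p : ι → Prop) (i : Subtype p) :
    restrict p (delta (i : ι)) = delta i := by
  ext j
  rw [restrict_apply, delta_apply, delta_apply]
  by_cases e : j = i
  · simp [e]
  · have e' : (j : ι) ≠ i := fun h => e (Subtype.ext h)
    simp [e, e']

theorem restrict_delta_of_not {ι : Type*} (p : ι → Prop) {i : ι} (h : ¬ p i) :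
    restrict p (delta i) = 0 := by
  ext j
  have : (j : ι) ≠ i := fun e => h (e ▸ j.2)
  simp [restrict_apply, delta_apply, this]

theorem extendZero_apply {ι : Type*} (p : ι → Prop) (ξ : Ell2 (Subtype p)) (i : Subtype p) :
    (extendZero p ξ : ι → ℂ) i = (ξ : Subtype p → ℂ) i := by
  rw [← inner_delta, extendZero, ContinuousLinearMap.adjoint_inner_right, restrict_delta,
    inner_delta]

theorem extendZero_apply_of_not {ι : Type*} (p : ι → Prop) (ξ : Ell2 (Subtype p)) {i : ι}
    (h : ¬ p i) : (extendZero p ξ : ι → ℂ) i = 0 := by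
  rw [← inner_delta, extendZero, ContinuousLinearMap.adjoint_inner_right,
    restrict_delta_of_not p h, inner_zero_left]

theorem restrict_extendZero {ι : Type*} (p : ι → Prop) (ξ : Ell2 (Subtype p)) :
    restrict p (extendZero p ξ) = ξ := by
  ext i
  rw [restrict_apply, extendZero_apply]

theorem extendZero_delta {ι : Type*} (p : ι → Prop) (i : Subtype p) :
    extendZero p (delta i) = delta (i : ι) := by
  ext j
  by_cases h : p j
  · rw [extendZero_apply p _ ⟨j, h⟩, delta_apply, delta_apply]
    by_cases e : j = i
    · subst e
      simp
    · have e' : (⟨j, h⟩ : Subtype p) ≠ i := fun h' => e (congrArg Subtype.val h')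
      simp [e, e']
  · rw [extendZero_apply_of_not p _ h, delta_apply, if_neg]
    exact fun e => h (e ▸ i.2)

theorem adjoint_extendZero {ι : Type*} (p : ι → Prop) :
    ContinuousLinearMap.adjoint (extendZero p) = restrict p :=
  ContinuousLinearMap.adjoint_adjoint _

/-! ### Étale groupoids and their reduced C*-algebras -/

/-- A locally compact Hausdorff étale groupoid with space of arrows `G` and unit space `B`. The
product of `a` and `b` is defined when the source of `a` is the range of `b`. -/
structure EtaleGroupoid (G B : Type*) [TopologicalSpace G] [TopologicalSpace B] where
  src : G → B
  rng : G → B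
  unit : B → G
  inv : G → G
  mul : (a b : G) → src a = rng b → G
  src_unit : ∀ x, src (unit x) = x
  rng_unit : ∀ x, rng (unit x) = x
  src_inv : ∀ a, src (inv a) = rng a
  rng_inv : ∀ a, rng (inv a) = src a
  src_mul : ∀ a b h, src (mul a b h) = src b
  rng_mul : ∀ a b h, rng (mul a b h) = rng a
  mul_assoc : ∀ a b c hab hbc h₁ h₂, mul (mul a b hab) c h₁ = mul a (mul b c hbc) h₂
  unit_mul : ∀ a h, mul (unit (rng a)) a h = a
  mul_unit : ∀ a h, mul a (unit (src a)) h = a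
  inv_mul : ∀ a h, mul (inv a) a h = unit (src a)
  mul_inv : ∀ a h, mul a (inv a) h = unit (rng a)
  t2 : T2Space G
  locallyCompact : LocallyCompactSpace G
  continuous_unit : Continuous unit
  continuous_inv : Continuous inv
  continuous_mul : Continuous fun p : {p : G × G // src p.1 = rng p.2} => mul p.1.1 p.1.2 p.2
  isLocalHomeomorph_src : IsLocalHomeomorph src

namespace EtaleGroupoid

variable {G B : Type*} [TopologicalSpace G] [TopologicalSpace B] (𝒢 : EtaleGroupoid G B)

theorem mul_congr {a a' b b' : G} (ha : a = a') (hb : b = b') (h : 𝒢.src a = 𝒢.rng b)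
    (h' : 𝒢.src a' = 𝒢.rng b') : 𝒢.mul a b h = 𝒢.mul a' b' h' := by
  subst ha hb; rfl

theorem mul_unit' (a : G) (x : B) (h : 𝒢.src a = 𝒢.rng (𝒢.unit x)) : 𝒢.mul a (𝒢.unit x) h = a := by
  have : x = 𝒢.src a := by rw [h, 𝒢.rng_unit]
  subst this
  exact 𝒢.mul_unit a h

theorem unit_mul' (a : G) (x : B) (h : 𝒢.src (𝒢.unit x) = 𝒢.rng a) : 𝒢.mul (𝒢.unit x) a h = a := by
  have : x = 𝒢.rng a := by rw [← h, 𝒢.src_unit]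
  subst this
  exact 𝒢.unit_mul a h

/-- The arrow `a * b⁻¹`, defined when `a` and `b` have the same source. -/
def div (a b : G) (h : 𝒢.src a = 𝒢.src b) : G := 𝒢.mul a (𝒢.inv b) (h.trans (𝒢.rng_inv b).symm)

theorem src_div (a b : G) (h : 𝒢.src a = 𝒢.src b) : 𝒢.src (𝒢.div a b h) = 𝒢.rng b := by
  rw [div, 𝒢.src_mul, 𝒢.src_inv]

theorem rng_div (a b : G) (h : 𝒢.src a = 𝒢.src b) : 𝒢.rng (𝒢.div a b h) = 𝒢.rng a := by
  rw [div, 𝒢.rng_mul]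

theorem div_mul (a b : G) (h : 𝒢.src a = 𝒢.src b) (h') : 𝒢.mul (𝒢.div a b h) b h' = a := by
  refine (𝒢.mul_assoc a (𝒢.inv b) b (h.trans (𝒢.rng_inv b).symm) (𝒢.src_inv b) h'
    (by rw [𝒢.rng_mul, 𝒢.rng_inv, h])).trans ?_
  rw [𝒢.mul_congr rfl (𝒢.inv_mul b (𝒢.src_inv b)) _ (by rw [𝒢.rng_unit, h]), 𝒢.mul_unit']

theorem mul_div (a b : G) (h : 𝒢.src a = 𝒢.rng b) (h') :
    𝒢.div (𝒢.mul a b h) b h' = a := by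
  rw [div, 𝒢.mul_assoc a b (𝒢.inv b) _ (𝒢.rng_inv b).symm _ (by rw [𝒢.rng_mul, h])]
  rw [𝒢.mul_congr rfl (𝒢.mul_inv b (𝒢.rng_inv b).symm) _ (by rw [𝒢.rng_unit, h]), 𝒢.mul_unit']

theorem mul_right_cancel {a a' b : G} {h : 𝒢.src a = 𝒢.rng b} {h' : 𝒢.src a' = 𝒢.rng b}
    (e : 𝒢.mul a b h = 𝒢.mul a' b h') : a = a' := by
  rw [← 𝒢.mul_div a b h (𝒢.src_mul _ _ _), ← 𝒢.mul_div a' b h' (𝒢.src_mul _ _ _)]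
  congr 1

theorem mul_left_cancel {a b b' : G} {h : 𝒢.src a = 𝒢.rng b} {h' : 𝒢.src a = 𝒢.rng b'}
    (e : 𝒢.mul a b h = 𝒢.mul a b' h') : b = b' := by
  have key : ∀ (c : G) (hc : 𝒢.src a = 𝒢.rng c) (h2),
      𝒢.mul (𝒢.inv a) (𝒢.mul a c hc) h2 = c := by
    intro c hc h2
    rw [← 𝒢.mul_assoc (𝒢.inv a) a c (𝒢.src_inv a) hc (by rw [𝒢.src_mul, hc]) h2]
    rw [𝒢.mul_congr (𝒢.inv_mul a (𝒢.src_inv a)) rfl _ (by rw [𝒢.src_unit, hc]), 𝒢.unit_mul']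
  rw [← key b h (by rw [𝒢.src_inv, 𝒢.rng_mul]), ← key b' h' (by rw [𝒢.src_inv, 𝒢.rng_mul])]
  exact 𝒢.mul_congr rfl e _ _

theorem inv_eq_of_mul {a b : G} (h : 𝒢.src a = 𝒢.rng b) (x : B) (e : 𝒢.mul a b h = 𝒢.unit x) :
    𝒢.inv b = a := by
  have hx : x = 𝒢.src b := by rw [← 𝒢.src_unit x, ← e, 𝒢.src_mul]
  subst hx
  exact 𝒢.mul_right_cancel ((𝒢.inv_mul b (𝒢.src_inv b)).trans e.symm)

theorem inv_inv (a : G) : 𝒢.inv (𝒢.inv a) = a :=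
  𝒢.inv_eq_of_mul (𝒢.rng_inv a).symm _ (𝒢.mul_inv a _)

theorem inv_div (a b : G) (h : 𝒢.src a = 𝒢.src b) : 𝒢.inv (𝒢.div a b h) = 𝒢.div b a h.symm := by
  refine 𝒢.inv_eq_of_mul (by rw [𝒢.src_div, 𝒢.rng_div]) (𝒢.rng b) ?_
  refine (𝒢.mul_assoc b (𝒢.inv a) (𝒢.div a b h) (by rw [𝒢.rng_inv, h])
    (by rw [𝒢.src_inv, 𝒢.rng_div]) (by rw [𝒢.src_mul, 𝒢.src_inv, 𝒢.rng_div])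
    (by rw [𝒢.rng_mul, 𝒢.rng_inv, h])).trans ?_
  rw [← 𝒢.mul_inv b (𝒢.rng_inv b).symm]
  refine 𝒢.mul_congr rfl ?_ _ _
  refine (𝒢.mul_assoc (𝒢.inv a) a (𝒢.inv b) (𝒢.src_inv a) (h.trans (𝒢.rng_inv b).symm)
    (by rw [𝒢.src_mul, 𝒢.rng_inv, h])
    (by rw [𝒢.src_inv, 𝒢.rng_mul])).symm.trans ?_
  rw [𝒢.mul_congr (𝒢.inv_mul a (𝒢.src_inv a)) rfl _ (by rw [𝒢.src_unit, 𝒢.rng_inv, h]),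
    𝒢.unit_mul']

theorem div_div (a b c : G) (hab : 𝒢.src a = 𝒢.src b) (hbc : 𝒢.src b = 𝒢.src c) (h) :
    𝒢.div (𝒢.div a c (hab.trans hbc)) (𝒢.div b c hbc) h = 𝒢.div a b hab := by
  apply 𝒢.mul_right_cancel (b := 𝒢.div b c hbc) (h := by rw [𝒢.src_div])
    (h' := by rw [𝒢.src_div, 𝒢.rng_div])
  rw [𝒢.div_mul]
  apply 𝒢.mul_right_cancel (b := c) (h := by rw [𝒢.src_div])
    (h' := by rw [𝒢.src_mul, 𝒢.src_div])
  rw [𝒢.div_mul, 𝒢.mul_assoc _ _ _ _ (by rw [𝒢.src_div]) _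
    (by rw [𝒢.rng_mul, 𝒢.src_div, 𝒢.rng_div])]
  rw [𝒢.mul_congr rfl (𝒢.div_mul b c hbc _) _ (by rw [𝒢.src_div]), 𝒢.div_mul]

theorem div_left_injective {a a' b : G} {h : 𝒢.src a = 𝒢.src b} {h' : 𝒢.src a' = 𝒢.src b}
    (e : 𝒢.div a b h = 𝒢.div a' b h') : a = a' := by
  rw [← 𝒢.div_mul a b h (𝒢.src_div _ _ _), ← 𝒢.div_mul a' b h' (𝒢.src_div _ _ _)]
  exact 𝒢.mul_congr e rfl _ _

theorem div_right_injective {a b b' : G} {h : 𝒢.src a = 𝒢.src b} {h' : 𝒢.src a = 𝒢.src b'}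
    (e : 𝒢.div a b h = 𝒢.div a b' h') : b = b' := by
  have := 𝒢.mul_left_cancel e
  rw [← 𝒢.inv_inv b, this, 𝒢.inv_inv]

theorem continuous_src : Continuous 𝒢.src := 𝒢.isLocalHomeomorph_src.continuous

theorem rng_eq : 𝒢.rng = 𝒢.src ∘ 𝒢.inv := funext fun a => (𝒢.src_inv a).symm

theorem continuous_rng : Continuous 𝒢.rng := by
  rw [𝒢.rng_eq]
  exact 𝒢.continuous_src.comp 𝒢.continuous_inv

theorem t2_base {G B : Type*} [TopologicalSpace G] [TopologicalSpace B] (𝒢 : EtaleGroupoid G B) :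
    T2Space B :=
  have := 𝒢.t2
  T2Space.of_injective_continuous (fun x y h => by rw [← 𝒢.src_unit x, h, 𝒢.src_unit])
    𝒢.continuous_unit

/-- The inverse map as a homeomorphism. -/
def invHomeo : G ≃ₜ G where
  toFun := 𝒢.inv
  invFun := 𝒢.inv
  left_inv := 𝒢.inv_inv
  right_inv := 𝒢.inv_inv
  continuous_toFun := 𝒢.continuous_inv
  continuous_invFun := 𝒢.continuous_inv

theorem exists_card_src {K : Set G} (hK : IsCompact K) :
    ∃ N : ℕ, ∀ x, {a ∈ K | 𝒢.src a = x}.encard ≤ N := by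
  have hU : ∀ a : G, ∃ U ∈ nhds a, Set.InjOn 𝒢.src U := fun a => by
    obtain ⟨U, hU, ha, hi⟩ := 𝒢.isLocalHomeomorph_src.isLocallyInjective a
    exact ⟨U, hU.mem_nhds ha, hi⟩
  choose U hU hi using hU
  obtain ⟨t, -, ht⟩ := hK.elim_nhds_subcover U fun a _ => hU a
  have : ∀ a ∈ K, ∃ c ∈ t, a ∈ U c := fun a ha => by simpa using ht ha
  choose! φ hφ hφ' using this
  refine ⟨t.card, fun x => ?_⟩
  rw [← Set.encard_coe_eq_coe_finsetCard]
  refine Set.encard_le_encard_of_injOn (f := φ) (fun a ha => hφ a ha.1) ?_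
  intro a ha b hb hab
  refine hi (φ a) (hφ' a ha.1) (hab ▸ hφ' b hb.1) (ha.2.trans hb.2.symm)

theorem exists_card_rng {K : Set G} (hK : IsCompact K) :
    ∃ N : ℕ, ∀ x, {a ∈ K | 𝒢.rng a = x}.encard ≤ N := by
  obtain ⟨N, hN⟩ := 𝒢.exists_card_src (hK.image 𝒢.continuous_inv)
  refine ⟨N, fun x => le_trans ?_ (hN x)⟩
  refine Set.encard_le_encard_of_injOn (f := 𝒢.inv)
    (fun a ha => ⟨Set.mem_image_of_mem _ ha.1, by rw [𝒢.src_inv, ha.2]⟩) ?_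
  exact 𝒢.invHomeo.injective.injOn

open scoped Classical in
/-- The matrix of left convolution by a function `f`: the entry at `(a, b)` is `f (a * b⁻¹)` if `a`
and `b` have the same source, and `0` otherwise. -/
def kern (f : G → ℂ) (a b : G) : ℂ := if h : 𝒢.src a = 𝒢.src b then f (𝒢.div a b h) else 0

theorem kern_of_eq (f : G → ℂ) {a b : G} (h : 𝒢.src a = 𝒢.src b) :
    𝒢.kern f a b = f (𝒢.div a b h) := dif_pos h

theorem kern_of_ne (f : G → ℂ) {a b : G} (h : 𝒢.src a ≠ 𝒢.src b) : 𝒢.kern f a b = 0 := dif_neg h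

theorem exists_band (f : C_c(G, ℂ)) : ∃ (N : ℕ) (M : ℝ), IsBandKernel (𝒢.kern f) N M := by
  classical
  obtain ⟨N₁, h₁⟩ := 𝒢.exists_card_src f.hasCompactSupport
  obtain ⟨N₂, h₂⟩ := 𝒢.exists_card_rng f.hasCompactSupport
  obtain ⟨M, hM⟩ := f.hasCompactSupport.exists_bound_of_continuous f.continuous
  refine ⟨max N₁ N₂, max M 0, le_max_right _ _, fun a => ?_, fun b => ?_, fun a b => ?_⟩
  · refine le_trans ?_ ((h₂ (𝒢.rng a)).trans (by exact_mod_cast le_max_right _ _))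
    have hs : ∀ b ∈ {b | 𝒢.kern f a b ≠ 0}, 𝒢.src a = 𝒢.src b := fun b hb => by
      by_contra h
      exact hb (𝒢.kern_of_ne f h)
    refine Set.encard_le_encard_of_injOn
      (f := fun b => if h : 𝒢.src a = 𝒢.src b then 𝒢.div a b h else a) ?_ ?_
    · intro b hb
      have h := hs b hb
      simp only [h, dite_true]
      refine ⟨subset_tsupport _ ?_, 𝒢.rng_div _ _ _⟩
      rw [Function.mem_support, ← 𝒢.kern_of_eq f h]
      exact hb
    · intro b hb c hc e
      simp only [dif_pos (hs b hb), dif_pos (hs c hc)] at e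
      exact 𝒢.div_right_injective e
  · refine le_trans ?_ ((h₁ (𝒢.rng b)).trans (by exact_mod_cast le_max_left _ _))
    have hs : ∀ a ∈ {a | 𝒢.kern f a b ≠ 0}, 𝒢.src a = 𝒢.src b := fun a ha => by
      by_contra h
      exact ha (𝒢.kern_of_ne f h)
    refine Set.encard_le_encard_of_injOn
      (f := fun a => if h : 𝒢.src a = 𝒢.src b then 𝒢.div a b h else a) ?_ ?_
    · intro a ha
      have h := hs a ha
      simp only [h, dite_true]
      refine ⟨subset_tsupport _ ?_, 𝒢.src_div _ _ _⟩
      rw [Function.mem_support, ← 𝒢.kern_of_eq f h]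
      exact ha
    · intro a ha c hc e
      simp only [dif_pos (hs a ha), dif_pos (hs c hc)] at e
      exact 𝒢.div_left_injective e
  · by_cases h : 𝒢.src a = 𝒢.src b
    · rw [𝒢.kern_of_eq f h]
      exact (hM _).trans (le_max_left _ _)
    · rw [𝒢.kern_of_ne f h, norm_zero]
      exact le_max_right _ _

/-- The left regular representation of a compactly supported continuous function `f`, given by
`(reg f ξ)(a) = ∑ f (a * b⁻¹) ξ(b)`, the sum being over all `b` with the same source as `a`.
The space `Ell2 G` is the direct sum over all units `x` of the spaces `Ell2` of the source fibres,
and `reg` is the direct sum of the regular representations at all units; in particular `‖reg f‖` is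
the reduced norm of `f`. -/
def reg (f : C_c(G, ℂ)) : BOp G := (𝒢.exists_band f).choose_spec.choose_spec.op

theorem reg_apply (f : C_c(G, ℂ)) (ξ : Ell2 G) (a : G) :
    (𝒢.reg f ξ : G → ℂ) a = ∑' b, 𝒢.kern f a b * (ξ : G → ℂ) b := rfl

theorem coeff_reg (f : C_c(G, ℂ)) (a b : G) : coeff (𝒢.reg f) a b = 𝒢.kern f a b :=
  (𝒢.exists_band f).choose_spec.choose_spec.coeff_op a b

theorem reg_add (f g : C_c(G, ℂ)) : 𝒢.reg (f + g) = 𝒢.reg f + 𝒢.reg g := by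
  refine op_ext fun a b => ?_
  rw [coeff_add]
  simp only [coeff_reg]
  by_cases h : 𝒢.src a = 𝒢.src b
  · simp [𝒢.kern_of_eq _ h]
  · simp [𝒢.kern_of_ne _ h]

theorem reg_smul (c : ℂ) (f : C_c(G, ℂ)) : 𝒢.reg (c • f) = c • 𝒢.reg f := by
  refine op_ext fun a b => ?_
  rw [coeff_smul]
  simp only [coeff_reg]
  by_cases h : 𝒢.src a = 𝒢.src b
  · simp [𝒢.kern_of_eq _ h]
  · simp [𝒢.kern_of_ne _ h]

theorem reg_zero : 𝒢.reg 0 = 0 := by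
  have := 𝒢.reg_smul 0 0
  simpa using this

theorem continuousOn_kern (f : C_c(G, ℂ)) :
    ContinuousOn (fun p : G × G => 𝒢.kern f p.1 p.2) {p | 𝒢.src p.1 = 𝒢.src p.2} := by
  rw [continuousOn_iff_continuous_domRestrict]
  have : ({p : G × G | 𝒢.src p.1 = 𝒢.src p.2}.domRestrict fun p => 𝒢.kern f p.1 p.2) =
      fun p => f (𝒢.div p.1.1 p.1.2 p.2) := by
    ext p
    exact 𝒢.kern_of_eq f p.2
  rw [this]
  refine f.continuous.comp ?_
  have h : Continuous fun p : {p : G × G | 𝒢.src p.1 = 𝒢.src p.2} =>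
      (⟨(p.1.1, 𝒢.inv p.1.2), p.2.trans (𝒢.rng_inv _).symm⟩ :
        {p : G × G // 𝒢.src p.1 = 𝒢.rng p.2}) :=
    Continuous.subtype_mk (by
      exact (continuous_fst.comp continuous_subtype_val).prodMk
        (𝒢.continuous_inv.comp (continuous_snd.comp continuous_subtype_val))) _
  exact 𝒢.continuous_mul.comp h

theorem continuous_conv (f g : C_c(G, ℂ)) : Continuous fun a => ∑' b, 𝒢.kern f a b * g b := by
  classical
  have := 𝒢.t2
  have := 𝒢.t2_base
  rw [continuous_iff_continuousAt]
  intro a₀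
  set K : Set G := tsupport g
  have hK : IsCompact K := g.hasCompactSupport
  obtain ⟨N, hN⟩ := 𝒢.exists_card_src hK
  have hF : {b ∈ K | 𝒢.src b = 𝒢.src a₀}.Finite := Set.finite_of_encard_le_coe (hN _)
  set F := hF.toFinset
  obtain ⟨V, hV, hVd⟩ := hF.t2_separation
  have hE := fun b => 𝒢.isLocalHomeomorph_src b
  choose e he hes using hE
  set V' : G → Set G := fun b => V b ∩ (e b).source
  have hV'o : ∀ b, IsOpen (V' b) := fun b => (hV b).2.inter (e b).open_source
  have hV'm : ∀ b, b ∈ V' b := fun b => ⟨(hV b).1, he b⟩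
  have hclosed : IsClosed (𝒢.src '' (K \ ⋃ b ∈ F, V' b)) :=
    ((hK.diff (isOpen_biUnion fun b _ => hV'o b)).image 𝒢.continuous_src).isClosed
  have hnot : 𝒢.src a₀ ∉ 𝒢.src '' (K \ ⋃ b ∈ F, V' b) := by
    rintro ⟨b, ⟨hb, hb'⟩, hs⟩
    apply hb'
    have : b ∈ F := by simp [F, hb, hs]
    exact Set.mem_biUnion this (hV'm b)
  have hFs : ∀ b ∈ F, 𝒢.src b = 𝒢.src a₀ := fun b hb => by
    have : b ∈ {b ∈ K | 𝒢.src b = 𝒢.src a₀} := by simpa [F] using hb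
    exact this.2
  have hW : ∀ᶠ x in nhds (𝒢.src a₀), x ∉ 𝒢.src '' (K \ ⋃ b ∈ F, V' b) ∧
      ∀ b ∈ F, x ∈ 𝒢.src '' V' b := by
    refine Filter.Eventually.and (hclosed.isOpen_compl.mem_nhds hnot) ?_
    rw [Filter.eventually_all_finset]
    intro b hb
    refine (𝒢.isLocalHomeomorph_src.isOpenMap _ (hV'o b)).mem_nhds ?_
    exact ⟨b, hV'm b, hFs b hb⟩
  have hσ : ∀ b x, x ∈ 𝒢.src '' V' b → (e b).symm x ∈ V' b ∧ 𝒢.src ((e b).symm x) = x := by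
    rintro b x ⟨c, hc, rfl⟩
    have : (e b).symm (𝒢.src c) = c := by
      rw [hes b]
      exact (e b).left_inv hc.2
    rw [this]
    exact ⟨hc, rfl⟩
  have heq : (fun a => ∑' b, 𝒢.kern f a b * g b) =ᶠ[nhds a₀] fun a =>
      ∑ b ∈ F, 𝒢.kern f a ((e b).symm (𝒢.src a)) * g ((e b).symm (𝒢.src a)) := by
    filter_upwards [𝒢.continuous_src.continuousAt.eventually hW] with a ha
    rw [← Finset.sum_image (s := F) (g := fun b => (e b).symm (𝒢.src a))
      (f := fun b => 𝒢.kern f a b * g b)]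
    · refine tsum_eq_sum fun c hc => ?_
      by_contra hne
      have hg : g c ≠ 0 := right_ne_zero_of_mul hne
      have hs : 𝒢.src a = 𝒢.src c := by
        by_contra h
        exact left_ne_zero_of_mul hne (𝒢.kern_of_ne f h)
      have hcK : c ∈ K := subset_tsupport _ hg
      have : c ∈ ⋃ b ∈ F, V' b := by
        by_contra h
        exact ha.1 ⟨c, ⟨hcK, h⟩, hs.symm⟩
      simp only [Set.mem_iUnion] at this
      obtain ⟨b, hb, hcb⟩ := this
      refine hc (Finset.mem_image.2 ⟨b, hb, ?_⟩)
      rw [hs, hes b]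
      exact (e b).left_inv hcb.2
    · intro b hb c hc hbc
      by_contra hne
      have hb' : b ∈ {b ∈ K | 𝒢.src b = 𝒢.src a₀} := by simpa [F] using hb
      have hc' : c ∈ {b ∈ K | 𝒢.src b = 𝒢.src a₀} := by simpa [F] using hc
      have h1 := (hσ b _ (ha.2 b hb)).1.1
      have h2 := (hσ c _ (ha.2 c hc)).1.1
      simp only at hbc
      rw [hbc] at h1
      exact Set.disjoint_left.1 (hVd hb' hc' hne) h1 h2
  refine ContinuousAt.congr ?_ heq.symm
  refine tendsto_finsetSum _ fun b hb => ?_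
  have hsy : ContinuousAt (fun a => (e b).symm (𝒢.src a)) a₀ := by
    refine ContinuousAt.comp (g := (e b).symm) ?_ 𝒢.continuous_src.continuousAt
    refine (e b).continuousAt_symm ?_
    rw [← hFs b hb, hes b]
    exact (e b).map_source (he b)
  refine ContinuousAt.mul ?_ (g.continuous.continuousAt.comp hsy)
  have h0 : (a₀, (e b).symm (𝒢.src a₀)) ∈ {p : G × G | 𝒢.src p.1 = 𝒢.src p.2} :=
    (hσ b _ (hW.self_of_nhds.2 b hb)).2.symm
  refine Filter.Tendsto.comp (𝒢.continuousOn_kern f _ h0)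
    (tendsto_nhdsWithin_iff.2 ⟨continuousAt_id.prodMk hsy, ?_⟩)
  filter_upwards [𝒢.continuous_src.continuousAt.eventually hW] with a ha
  exact (hσ b _ (ha.2 b hb)).2.symm

theorem hasCompactSupport_conv (f g : C_c(G, ℂ)) :
    HasCompactSupport fun a => ∑' b, 𝒢.kern f a b * g b := by
  have := 𝒢.t2
  have := 𝒢.t2_base
  have hc : IsClosed {p : G × G | 𝒢.src p.1 = 𝒢.rng p.2} :=
    isClosed_eq (𝒢.continuous_src.comp continuous_fst) (𝒢.continuous_rng.comp continuous_snd)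
  have hK := ((hc.isClosedEmbedding_subtypeVal).isCompact_preimage
    (f.hasCompactSupport.prod g.hasCompactSupport)).image 𝒢.continuous_mul
  refine HasCompactSupport.intro hK fun a ha => ?_
  refine (tsum_congr fun b => ?_).trans tsum_zero
  by_contra hne
  have hg : g b ≠ 0 := right_ne_zero_of_mul hne
  have hk := left_ne_zero_of_mul hne
  have hs : 𝒢.src a = 𝒢.src b := by
    by_contra h
    exact hk (𝒢.kern_of_ne f h)
  rw [𝒢.kern_of_eq f hs] at hk
  exact ha ⟨⟨(𝒢.div a b hs, b), 𝒢.src_div a b hs⟩, ⟨subset_tsupport _ hk, subset_tsupport _ hg⟩,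
    𝒢.div_mul a b hs (𝒢.src_div a b hs)⟩

/-- The convolution product, `(f * g)(a) = ∑ f (a * b⁻¹) g(b)`, the sum being over all `b` with the
same source as `a`. -/
def conv (f g : C_c(G, ℂ)) : C_c(G, ℂ) where
  toFun a := ∑' b, 𝒢.kern f a b * g b
  continuous_toFun := 𝒢.continuous_conv f g
  hasCompactSupport' := 𝒢.hasCompactSupport_conv f g

/-- The involution, `f*(a) = conj (f (a⁻¹))`. -/
def invol (f : C_c(G, ℂ)) : C_c(G, ℂ) where
  toFun a := starRingEnd ℂ (f (𝒢.inv a))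
  continuous_toFun := Complex.continuous_conj.comp (f.continuous.comp 𝒢.continuous_inv)
  hasCompactSupport' := by
    have h : HasCompactSupport (f ∘ 𝒢.invHomeo) := f.hasCompactSupport.comp_homeomorph _
    exact h.comp_left (g := starRingEnd ℂ) (map_zero _)

theorem conv_apply (f g : C_c(G, ℂ)) (a : G) : 𝒢.conv f g a = ∑' b, 𝒢.kern f a b * g b := rfl

theorem invol_apply (f : C_c(G, ℂ)) (a : G) : 𝒢.invol f a = starRingEnd ℂ (f (𝒢.inv a)) := rfl

theorem reg_conv (f g : C_c(G, ℂ)) : 𝒢.reg (𝒢.conv f g) = 𝒢.reg f * 𝒢.reg g := by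
  refine op_ext fun a c => ?_
  have h1 := (hasSum_coeff_mul (𝒢.reg f) (𝒢.reg g) a c).tsum_eq
  change _ = coeff ((𝒢.reg f).comp (𝒢.reg g)) a c
  rw [← h1]
  simp only [coeff_reg]
  by_cases h : 𝒢.src a = 𝒢.src c
  · rw [𝒢.kern_of_eq _ h, conv_apply]
    have e1 : Function.support (fun b => 𝒢.kern f (𝒢.div a c h) b * g b) ⊆
        {b | 𝒢.src b = 𝒢.rng c} := fun b hb => by
      by_contra hn
      refine left_ne_zero_of_mul hb (𝒢.kern_of_ne f fun h' => hn ?_)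
      rw [Set.mem_ofPred_eq, ← h', 𝒢.src_div]
    have e2 : Function.support (fun b => 𝒢.kern f a b * 𝒢.kern g b c) ⊆
        {b | 𝒢.src b = 𝒢.src c} := fun b hb => by
      by_contra hn
      exact right_ne_zero_of_mul hb (𝒢.kern_of_ne g hn)
    rw [← tsum_subtype_eq_of_support_subset e1, ← tsum_subtype_eq_of_support_subset e2]
    let φ : {b | 𝒢.src b = 𝒢.rng c} ≃ {b | 𝒢.src b = 𝒢.src c} :=
      { toFun := fun b => ⟨𝒢.mul b c b.2, 𝒢.src_mul _ _ _⟩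
        invFun := fun b => ⟨𝒢.div b c b.2, 𝒢.src_div _ _ _⟩
        left_inv := fun b => Subtype.ext (𝒢.mul_div _ _ b.2 (𝒢.src_mul _ _ _))
        right_inv := fun b => Subtype.ext (𝒢.div_mul _ _ b.2 (𝒢.src_div _ _ _)) }
    rw [← φ.symm.tsum_eq]
    refine tsum_congr fun b => ?_
    have hb : 𝒢.src a = 𝒢.src b := h.trans b.2.symm
    change 𝒢.kern f (𝒢.div a c h) (𝒢.div b c b.2) * g (𝒢.div b c b.2) = _
    rw [𝒢.kern_of_eq g b.2, 𝒢.kern_of_eq f hb,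
      𝒢.kern_of_eq f (by rw [𝒢.src_div, 𝒢.src_div])]
    congr 2
    exact 𝒢.div_div _ _ _ hb b.2 _
  · rw [𝒢.kern_of_ne _ h]
    symm
    refine (tsum_congr fun b => ?_).trans tsum_zero
    by_cases h' : 𝒢.src a = 𝒢.src b
    · rw [𝒢.kern_of_ne g fun e => h (h'.trans e), mul_zero]
    · rw [𝒢.kern_of_ne f h', zero_mul]

theorem reg_invol (f : C_c(G, ℂ)) : 𝒢.reg (𝒢.invol f) = star (𝒢.reg f) := by
  refine op_ext fun a b => ?_
  rw [coeff_star]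
  simp only [coeff_reg]
  by_cases h : 𝒢.src a = 𝒢.src b
  · rw [𝒢.kern_of_eq _ h, 𝒢.kern_of_eq _ h.symm, invol_apply, 𝒢.inv_div]
  · rw [𝒢.kern_of_ne _ h, 𝒢.kern_of_ne _ (Ne.symm h), map_zero]

/-- The image of the convolution algebra under the regular representation. -/
def regAlgebra : NonUnitalStarSubalgebra ℂ (BOp G) where
  carrier := Set.range 𝒢.reg
  add_mem' := by
    rintro _ _ ⟨f, rfl⟩ ⟨g, rfl⟩
    exact ⟨f + g, 𝒢.reg_add f g⟩
  zero_mem' := ⟨0, 𝒢.reg_zero⟩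
  mul_mem' := by
    rintro _ _ ⟨f, rfl⟩ ⟨g, rfl⟩
    exact ⟨𝒢.conv f g, 𝒢.reg_conv f g⟩
  smul_mem' := by
    rintro c _ ⟨f, rfl⟩
    exact ⟨c • f, 𝒢.reg_smul c f⟩
  star_mem' := by
    rintro _ ⟨f, rfl⟩
    exact ⟨𝒢.invol f, 𝒢.reg_invol f⟩

/-- The reduced C*-algebra of an étale groupoid: the completion of the convolution algebra in the
reduced norm, realised as the norm closure of its image under the regular representation. -/
def reducedCStar : NonUnitalStarSubalgebra ℂ (BOp G) := 𝒢.regAlgebra.topologicalClosure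

theorem reg_mem (f : C_c(G, ℂ)) : 𝒢.reg f ∈ 𝒢.reducedCStar :=
  NonUnitalStarSubalgebra.le_topologicalClosure _ ⟨f, rfl⟩

/-- A compactly supported continuous function as an element of the reduced C*-algebra. -/
def ofCc (f : C_c(G, ℂ)) : 𝒢.reducedCStar := ⟨𝒢.reg f, 𝒢.reg_mem f⟩

/-- A set of units is invariant if its preimages under range and source agree. -/
def IsInvariant (Y : Set B) : Prop := 𝒢.rng ⁻¹' Y = 𝒢.src ⁻¹' Y

variable {𝒢} in
theorem IsInvariant.mem_iff {Y : Set B} (hY : 𝒢.IsInvariant Y) (a : G) :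
    𝒢.rng a ∈ Y ↔ 𝒢.src a ∈ Y := Set.ext_iff.1 hY a

variable {𝒢} in
theorem IsInvariant.compl {Y : Set B} (hY : 𝒢.IsInvariant Y) : 𝒢.IsInvariant Yᶜ := by
  rw [IsInvariant, Set.preimage_compl, Set.preimage_compl, hY]

/-- The arrows of the reduction to an invariant set of units `Y`, the arrows with source in `Y`. -/
abbrev Arrows (Y : Set B) : Type _ := {a : G // 𝒢.src a ∈ Y}

theorem isLocalHomeomorph_restrictPreimage (Y : Set B) :
    IsLocalHomeomorph (Y.restrictPreimage 𝒢.src) := by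
  rw [isLocalHomeomorph_iff_isOpenEmbedding_restrict]
  intro a
  obtain ⟨V, hV, ha, hi⟩ := 𝒢.isLocalHomeomorph_src.isLocallyInjective (a : G)
  have hV' : IsOpen (Subtype.val ⁻¹' V : Set (𝒢.src ⁻¹' Y)) := hV.preimage continuous_subtype_val
  refine ⟨_, hV'.mem_nhds ha, ?_⟩
  refine Topology.IsOpenEmbedding.of_continuous_injective_isOpenMap ?_ ?_ ?_
  · exact (𝒢.continuous_src.restrictPreimage).comp continuous_subtype_val
  · intro b c h
    exact Subtype.ext (Subtype.ext (hi b.2 c.2 (congrArg Subtype.val h)))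
  · exact (𝒢.isLocalHomeomorph_src.isOpenMap.restrictPreimage Y).comp hV'.isOpenMap_subtype_val

theorem continuous_mul_arrows (Y : Set B) (hY : 𝒢.IsInvariant Y) :
    Continuous fun p : {p : 𝒢.Arrows Y × 𝒢.Arrows Y //
      (⟨𝒢.src p.1, p.1.2⟩ : Y) = ⟨𝒢.rng p.2, (hY.mem_iff p.2.1).2 p.2.2⟩} =>
        𝒢.mul p.1.1 p.1.2 (congrArg Subtype.val p.2) := by
  have h : Continuous fun p : {p : 𝒢.Arrows Y × 𝒢.Arrows Y //
      (⟨𝒢.src p.1, p.1.2⟩ : Y) = ⟨𝒢.rng p.2, (hY.mem_iff p.2.1).2 p.2.2⟩} =>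
        (⟨(p.1.1.1, p.1.2.1), congrArg Subtype.val p.2⟩ :
          {p : G × G // 𝒢.src p.1 = 𝒢.rng p.2}) :=
    Continuous.subtype_mk ((continuous_subtype_val.comp
      (continuous_fst.comp continuous_subtype_val)).prodMk
      (continuous_subtype_val.comp (continuous_snd.comp continuous_subtype_val))) _
  exact 𝒢.continuous_mul.comp h

theorem src_unit_mem {Y : Set B} (x : Y) : 𝒢.src (𝒢.unit x) ∈ Y := by
  rw [𝒢.src_unit]
  exact x.2

theorem src_inv_mem {Y : Set B} (hY : 𝒢.IsInvariant Y) (a : 𝒢.Arrows Y) :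
    𝒢.src (𝒢.inv a) ∈ Y := by
  rw [𝒢.src_inv]
  exact (hY.mem_iff a.1).2 a.2

theorem src_mul_mem {Y : Set B} (a : G) (b : 𝒢.Arrows Y) (h : 𝒢.src a = 𝒢.rng b) :
    𝒢.src (𝒢.mul a b h) ∈ Y := by
  rw [𝒢.src_mul]
  exact b.2

theorem t2_arrows (Y : Set B) : T2Space (𝒢.Arrows Y) := by
  have := 𝒢.t2
  infer_instance

theorem locallyCompact_arrows (Y : Set B) (hc : IsLocallyClosed Y) :
    LocallyCompactSpace (𝒢.Arrows Y) := by
  have := 𝒢.locallyCompact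
  have := 𝒢.t2
  have h : IsLocallyClosed (𝒢.src ⁻¹' Y) := hc.preimage 𝒢.continuous_src
  exact (Topology.IsInducing.subtypeVal (t := 𝒢.src ⁻¹' Y)).locallyCompactSpace
    (by rwa [Subtype.range_val])

/-- The reduction of an étale groupoid to a locally closed invariant set of units. -/
def reduction (Y : Set B) (hY : 𝒢.IsInvariant Y) (hc : IsLocallyClosed Y) :
    EtaleGroupoid (𝒢.Arrows Y) Y where
  src a := ⟨𝒢.src a, a.2⟩
  rng a := ⟨𝒢.rng a, (hY.mem_iff a.1).2 a.2⟩
  unit x := ⟨𝒢.unit x, 𝒢.src_unit_mem x⟩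
  inv a := ⟨𝒢.inv a, 𝒢.src_inv_mem hY a⟩
  mul a b h := ⟨𝒢.mul a b (congrArg Subtype.val h), 𝒢.src_mul_mem a.1 b _⟩
  src_unit x := Subtype.ext (𝒢.src_unit x)
  rng_unit x := Subtype.ext (𝒢.rng_unit x)
  src_inv a := Subtype.ext (𝒢.src_inv a)
  rng_inv a := Subtype.ext (𝒢.rng_inv a)
  src_mul a b _ := Subtype.ext (𝒢.src_mul a b _)
  rng_mul a b _ := Subtype.ext (𝒢.rng_mul a b _)
  mul_assoc a b c hab hbc _ _ := Subtype.ext (𝒢.mul_assoc a b c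
    (congrArg Subtype.val hab) (congrArg Subtype.val hbc) _ _)
  unit_mul a _ := Subtype.ext (𝒢.unit_mul a _)
  mul_unit a _ := Subtype.ext (𝒢.mul_unit a _)
  inv_mul a _ := Subtype.ext (𝒢.inv_mul a _)
  mul_inv a _ := Subtype.ext (𝒢.mul_inv a _)
  t2 := 𝒢.t2_arrows Y
  locallyCompact := 𝒢.locallyCompact_arrows Y hc
  continuous_unit := (𝒢.continuous_unit.comp continuous_subtype_val).subtype_mk _
  continuous_inv := (𝒢.continuous_inv.comp continuous_subtype_val).subtype_mk _
  continuous_mul := (𝒢.continuous_mul_arrows Y hY).subtype_mk _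
  isLocalHomeomorph_src := 𝒢.isLocalHomeomorph_restrictPreimage Y

section Maps

variable (Y : Set B) (hY : 𝒢.IsInvariant Y)

/-- Restriction of compactly supported functions to the reduction to a closed invariant set. -/
def restrictCc (hc : IsClosed Y) (f : C_c(G, ℂ)) : C_c(𝒢.Arrows Y, ℂ) where
  toFun a := f a
  continuous_toFun := f.continuous.comp continuous_subtype_val
  hasCompactSupport' := f.hasCompactSupport.comp_isClosedEmbedding
    (hc.preimage 𝒢.continuous_src).isClosedEmbedding_subtypeVal

open scoped Classical in
/-- Extension by zero of compactly supported functions from the reduction to an open invariant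
set. -/
def extendCc (ho : IsOpen Y) (f : C_c(𝒢.Arrows Y, ℂ)) : C_c(G, ℂ) where
  toFun a := if h : 𝒢.src a ∈ Y then f ⟨a, h⟩ else 0
  continuous_toFun := by
    have := 𝒢.t2
    have h := HasCompactSupport.continuous_extend_zero (ho.preimage 𝒢.continuous_src)
      f.continuous f.hasCompactSupport
    convert h using 1
    ext a
    by_cases ha : 𝒢.src a ∈ Y
    · rw [dif_pos ha]
      exact (Subtype.val_injective.extend_apply f 0 (⟨a, ha⟩ : 𝒢.Arrows Y)).symm
    · rw [dif_neg ha, Function.extend_apply']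
      · rfl
      · rintro ⟨b, rfl⟩
        exact ha b.2
  hasCompactSupport' := by
    have := 𝒢.t2
    refine HasCompactSupport.intro (f.hasCompactSupport.isCompact.image continuous_subtype_val)
      fun a ha => ?_
    by_cases h : 𝒢.src a ∈ Y
    · rw [dif_pos h]
      by_contra hne
      exact ha ⟨⟨a, h⟩, subset_tsupport _ hne, rfl⟩
    · rw [dif_neg h]

theorem restrictCc_apply (hc : IsClosed Y) (f : C_c(G, ℂ)) (a : 𝒢.Arrows Y) :
    𝒢.restrictCc Y hc f a = f a := rfl

theorem extendCc_apply (ho : IsOpen Y) (f : C_c(𝒢.Arrows Y, ℂ)) (a : 𝒢.Arrows Y) :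
    𝒢.extendCc Y ho f a = f a := dif_pos a.2

theorem extendCc_apply_of_not (ho : IsOpen Y) (f : C_c(𝒢.Arrows Y, ℂ)) {a : G}
    (h : 𝒢.src a ∉ Y) : 𝒢.extendCc Y ho f a = 0 := dif_neg h

theorem kern_reduction (hlc : IsLocallyClosed Y) (f : G → ℂ) (g : 𝒢.Arrows Y → ℂ)
    (hfg : ∀ a, g a = f a) (a b : 𝒢.Arrows Y) :
    (𝒢.reduction Y hY hlc).kern g a b = 𝒢.kern f a b := by
  by_cases h : 𝒢.src a = 𝒢.src b
  · rw [𝒢.kern_of_eq f h, (𝒢.reduction Y hY hlc).kern_of_eq g (Subtype.ext h), hfg]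
    rfl
  · rw [𝒢.kern_of_ne f h, (𝒢.reduction Y hY hlc).kern_of_ne g fun e => h (congrArg Subtype.val e)]

/-- Compression of operators from the arrows of `𝒢` to the arrows of a reduction. -/
def compress (T : BOp G) : BOp (𝒢.Arrows Y) :=
  (restrict fun a => 𝒢.src a ∈ Y).comp (T.comp (extendZero fun a => 𝒢.src a ∈ Y))

/-- Extension by zero of operators from the arrows of a reduction to the arrows of `𝒢`. -/
def inflate (T : BOp (𝒢.Arrows Y)) : BOp G :=
  (extendZero fun a => 𝒢.src a ∈ Y).comp (T.comp (restrict fun a => 𝒢.src a ∈ Y))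

theorem coeff_compress (T : BOp G) (a b : 𝒢.Arrows Y) :
    coeff (𝒢.compress Y T) a b = coeff T a b := by
  simp only [coeff, compress, ContinuousLinearMap.comp_apply, restrict_apply]
  rw [extendZero_delta]

theorem coeff_inflate (T : BOp (𝒢.Arrows Y)) (a b : 𝒢.Arrows Y) :
    coeff (𝒢.inflate Y T) a b = coeff T a b := by
  simp only [coeff, inflate, ContinuousLinearMap.comp_apply]
  rw [restrict_delta (fun a => 𝒢.src a ∈ Y) b, extendZero_apply (fun a => 𝒢.src a ∈ Y) _ a]

theorem coeff_inflate_left (T : BOp (𝒢.Arrows Y)) {a : G} (b : G) (h : 𝒢.src a ∉ Y) :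
    coeff (𝒢.inflate Y T) a b = 0 := by
  simp only [coeff, inflate, ContinuousLinearMap.comp_apply]
  rw [extendZero_apply_of_not (fun a => 𝒢.src a ∈ Y) _ h]

theorem coeff_inflate_right (T : BOp (𝒢.Arrows Y)) (a : G) {b : G} (h : 𝒢.src b ∉ Y) :
    coeff (𝒢.inflate Y T) a b = 0 := by
  simp only [coeff, inflate, ContinuousLinearMap.comp_apply]
  rw [restrict_delta_of_not (fun a => 𝒢.src a ∈ Y) h]
  simp

theorem continuous_compress : Continuous (𝒢.compress Y) := by
  unfold compress
  fun_prop

theorem continuous_inflate : Continuous (𝒢.inflate Y) := by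
  unfold inflate
  fun_prop

theorem compress_star (T : BOp G) : 𝒢.compress Y (star T) = star (𝒢.compress Y T) :=
  op_ext fun a b => by rw [coeff_star, coeff_compress, coeff_compress, coeff_star]

theorem inflate_star (T : BOp (𝒢.Arrows Y)) : 𝒢.inflate Y (star T) = star (𝒢.inflate Y T) := by
  refine op_ext fun a b => ?_
  rw [coeff_star]
  by_cases ha : 𝒢.src a ∈ Y
  · by_cases hb : 𝒢.src b ∈ Y
    · rw [𝒢.coeff_inflate Y _ ⟨a, ha⟩ ⟨b, hb⟩, 𝒢.coeff_inflate Y _ ⟨b, hb⟩ ⟨a, ha⟩, coeff_star]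
    · rw [𝒢.coeff_inflate_right Y _ _ hb, 𝒢.coeff_inflate_left Y _ _ hb, map_zero]
  · rw [𝒢.coeff_inflate_left Y _ _ ha, 𝒢.coeff_inflate_right Y _ _ ha, map_zero]

theorem inflate_mul (T S : BOp (𝒢.Arrows Y)) :
    𝒢.inflate Y (T * S) = 𝒢.inflate Y T * 𝒢.inflate Y S := by
  ext1 ξ
  simp only [inflate, mul_apply_eq_comp, ContinuousLinearMap.comp_apply,
    restrict_extendZero]

theorem compress_reg (hc : IsClosed Y) (f : C_c(G, ℂ)) : 𝒢.compress Y (𝒢.reg f) =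
    (𝒢.reduction Y hY hc.isLocallyClosed).reg (𝒢.restrictCc Y hc f) := by
  refine op_ext fun a b => ?_
  rw [coeff_compress, coeff_reg, coeff_reg]
  exact (𝒢.kern_reduction Y hY _ f _ (fun _ => rfl) a b).symm

theorem inflate_reg (ho : IsOpen Y) (f : C_c(𝒢.Arrows Y, ℂ)) :
    𝒢.inflate Y ((𝒢.reduction Y hY ho.isLocallyClosed).reg f) = 𝒢.reg (𝒢.extendCc Y ho f) := by
  refine op_ext fun a b => ?_
  rw [coeff_reg]
  by_cases h : 𝒢.src a = 𝒢.src b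
  · by_cases ha : 𝒢.src a ∈ Y
    · rw [𝒢.coeff_inflate Y _ ⟨a, ha⟩ ⟨b, h ▸ ha⟩, coeff_reg]
      exact 𝒢.kern_reduction Y hY _ _ f (fun c => (𝒢.extendCc_apply Y ho f c).symm) _ _
    · rw [𝒢.coeff_inflate_left Y _ _ ha, 𝒢.kern_of_eq _ h, 𝒢.extendCc_apply_of_not Y ho]
      rw [𝒢.src_div, hY.mem_iff, ← h]
      exact ha
  · rw [𝒢.kern_of_ne _ h]
    by_cases ha : 𝒢.src a ∈ Y
    · by_cases hb : 𝒢.src b ∈ Y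
      · rw [𝒢.coeff_inflate Y _ ⟨a, ha⟩ ⟨b, hb⟩, coeff_reg]
        exact kern_of_ne _ _ fun e => h (congrArg Subtype.val e)
      · rw [𝒢.coeff_inflate_right Y _ _ hb]
    · rw [𝒢.coeff_inflate_left Y _ _ ha]

theorem restrict_comp_of_mem {T : BOp G} (hT : T ∈ 𝒢.reducedCStar) (ξ : Ell2 G) :
    restrict (fun a => 𝒢.src a ∈ Y) (T ξ) = restrict (fun a => 𝒢.src a ∈ Y)
      (T (extendZero (fun a => 𝒢.src a ∈ Y) (restrict (fun a => 𝒢.src a ∈ Y) ξ))) := by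
  let L : BOp G → (Ell2 G →L[ℂ] Ell2 (𝒢.Arrows Y)) := fun T =>
    (restrict fun a => 𝒢.src a ∈ Y).comp T
  let R : BOp G → (Ell2 G →L[ℂ] Ell2 (𝒢.Arrows Y)) := fun T =>
    (𝒢.compress Y T).comp (restrict fun a => 𝒢.src a ∈ Y)
  have hL : Continuous L := by fun_prop
  have hR : Continuous R := by
    have := 𝒢.continuous_compress Y
    fun_prop
  have hcl : T ∈ closure (Set.range 𝒢.reg) := hT
  have hsub : Set.range 𝒢.reg ⊆ {T | L T = R T} := by
    rintro _ ⟨f, rfl⟩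
    refine op_ext fun a b => ?_
    have h1 : coeff (L (𝒢.reg f)) a b = 𝒢.kern f a b := 𝒢.coeff_reg f a b
    rw [h1]
    simp only [R, coeff, ContinuousLinearMap.comp_apply]
    by_cases hb : 𝒢.src b ∈ Y
    · rw [restrict_delta (fun a => 𝒢.src a ∈ Y) ⟨b, hb⟩]
      change _ = coeff (𝒢.compress Y (𝒢.reg f)) a ⟨b, hb⟩
      rw [coeff_compress, coeff_reg]
    · rw [restrict_delta_of_not (fun a => 𝒢.src a ∈ Y) hb, map_zero]
      exact 𝒢.kern_of_ne f fun e => hb (e ▸ a.2)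
  have : L T = R T := closure_minimal hsub (isClosed_eq hL hR) hcl
  exact DFunLike.congr_fun this ξ

theorem compress_mul {T : BOp G} (hT : T ∈ 𝒢.reducedCStar) (S : BOp G) :
    𝒢.compress Y (T * S) = 𝒢.compress Y T * 𝒢.compress Y S := by
  ext1 ξ
  simp only [compress, mul_apply_eq_comp, ContinuousLinearMap.comp_apply]
  exact 𝒢.restrict_comp_of_mem Y hT _

theorem compress_mem (hc : IsClosed Y) {T : BOp G} (hT : T ∈ 𝒢.reducedCStar) :
    𝒢.compress Y T ∈ (𝒢.reduction Y hY hc.isLocallyClosed).reducedCStar := by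
  have hcl : T ∈ closure (Set.range 𝒢.reg) := hT
  refine map_mem_closure (𝒢.continuous_compress Y) hcl ?_
  rintro _ ⟨f, rfl⟩
  exact ⟨_, (𝒢.compress_reg Y hY hc f).symm⟩

theorem inflate_mem (ho : IsOpen Y) {T : BOp (𝒢.Arrows Y)}
    (hT : T ∈ (𝒢.reduction Y hY ho.isLocallyClosed).reducedCStar) :
    𝒢.inflate Y T ∈ 𝒢.reducedCStar := by
  have hcl : T ∈ closure (Set.range (𝒢.reduction Y hY ho.isLocallyClosed).reg) := hT
  refine map_mem_closure (𝒢.continuous_inflate Y) hcl ?_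
  rintro _ ⟨f, rfl⟩
  exact ⟨_, (𝒢.inflate_reg Y hY ho f).symm⟩

/-- The homomorphism of reduced C*-algebras that extends the restriction of compactly supported
functions to the reduction to a closed invariant set `Y`. -/
def restrictionHom (hc : IsClosed Y) :
    𝒢.reducedCStar →⋆ₙₐ[ℂ] (𝒢.reduction Y hY hc.isLocallyClosed).reducedCStar where
  toFun T := ⟨𝒢.compress Y T, 𝒢.compress_mem Y hY hc T.2⟩
  map_smul' c T := Subtype.ext (op_ext fun a b => by
    change coeff (𝒢.compress Y (c • (T : BOp G))) a b = coeff (c • 𝒢.compress Y (T : BOp G)) a b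
    simp only [coeff_compress, coeff_smul])
  map_zero' := Subtype.ext (op_ext fun a b => by
    change coeff (𝒢.compress Y 0) a b = coeff 0 a b
    simp only [coeff_compress, coeff_zero])
  map_add' T S := Subtype.ext (op_ext fun a b => by
    change coeff (𝒢.compress Y ((T : BOp G) + S)) a b =
      coeff (𝒢.compress Y (T : BOp G) + 𝒢.compress Y S) a b
    simp only [coeff_compress, coeff_add])
  map_mul' T S := Subtype.ext (𝒢.compress_mul Y T.2 S)
  map_star' T := Subtype.ext (𝒢.compress_star Y T)

theorem restrictionHom_ofCc (hc : IsClosed Y) (f : C_c(G, ℂ)) :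
    𝒢.restrictionHom Y hY hc (𝒢.ofCc f) =
      (𝒢.reduction Y hY hc.isLocallyClosed).ofCc (𝒢.restrictCc Y hc f) :=
  Subtype.ext (𝒢.compress_reg Y hY hc f)

/-- The homomorphism of reduced C*-algebras that extends the extension by zero of compactly
supported functions from the reduction to an open invariant set `Y`. -/
def inclusionHom (ho : IsOpen Y) :
    (𝒢.reduction Y hY ho.isLocallyClosed).reducedCStar →⋆ₙₐ[ℂ] 𝒢.reducedCStar where
  toFun T := ⟨𝒢.inflate Y T, 𝒢.inflate_mem Y hY ho T.2⟩
  map_smul' c T := Subtype.ext (by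
    change 𝒢.inflate Y (c • (T : BOp (𝒢.Arrows Y))) = c • 𝒢.inflate Y (T : BOp (𝒢.Arrows Y))
    simp [inflate])
  map_zero' := Subtype.ext (by
    change 𝒢.inflate Y 0 = 0
    simp [inflate])
  map_add' T S := Subtype.ext (by
    change 𝒢.inflate Y ((T : BOp (𝒢.Arrows Y)) + S) =
      𝒢.inflate Y (T : BOp (𝒢.Arrows Y)) + 𝒢.inflate Y S
    simp [inflate, ContinuousLinearMap.add_comp, ContinuousLinearMap.comp_add])
  map_mul' T S := Subtype.ext (𝒢.inflate_mul Y T S)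
  map_star' T := Subtype.ext (𝒢.inflate_star Y T)

theorem inclusionHom_ofCc (ho : IsOpen Y) (f : C_c(𝒢.Arrows Y, ℂ)) :
    𝒢.inclusionHom Y hY ho ((𝒢.reduction Y hY ho.isLocallyClosed).ofCc f) =
      𝒢.ofCc (𝒢.extendCc Y ho f) :=
  Subtype.ext (𝒢.inflate_reg Y hY ho f)

end Maps

end EtaleGroupoid

/-! ### The coarse groupoid -/

/-- A metric space of bounded geometry: the closed balls of any given radius have uniformly bounded
cardinality. -/
class BoundedGeometry (X : Type*) [MetricSpace X] : Prop where
  exists_card_ball : ∀ R > 0, ∃ N : ℕ, ∀ x : X, (Metric.closedBall x R).encard ≤ N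

section Coarse

variable (X : Type*) [MetricSpace X]

/-- The set of pairs at distance at most `R`. -/
def entourage (R : ℝ) : Set (X × X) := {p | dist p.1 p.2 ≤ R}

/-- The underlying set of the coarse groupoid: the union of the closures of all entourages in the
Stone-Čech compactification of `X × X`, the space of ultrafilters on `X × X`. -/
def coarseArrows : Set (Ultrafilter (X × X)) :=
  ⋃ R > 0, closure ((pure : X × X → Ultrafilter (X × X)) '' entourage X R)

/-- The space of arrows of the coarse groupoid, with the topology of the Stone-Čech
compactification of `X × X`. -/
abbrev CoarseArrow : Type _ := coarseArrows X

variable {X}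

theorem closure_image_pure {Y : Type*} (A : Set Y) :
    closure ((pure : Y → Ultrafilter Y) '' A) = {u | A ∈ u} := by
  refine subset_antisymm (closure_minimal ?_ (ultrafilter_isClosed_basic A)) fun u hu => ?_
  · rintro _ ⟨y, hy, rfl⟩
    exact hy
  · rw [ultrafilterBasis_is_basis.mem_closure_iff]
    rintro _ ⟨s, rfl⟩ hs
    obtain ⟨y, hyA, hys⟩ := u.nonempty_of_mem (Filter.inter_mem hu hs)
    exact ⟨pure y, hys, y, hyA, rfl⟩

theorem mem_coarseArrows {u : Ultrafilter (X × X)} :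
    u ∈ coarseArrows X ↔ ∃ R > 0, entourage X R ∈ u := by
  simp [coarseArrows, closure_image_pure]

theorem isOpen_coarseArrows : IsOpen (coarseArrows X) := by
  refine isOpen_biUnion fun R _ => ?_
  rw [closure_image_pure]
  exact ultrafilter_isOpen_basic _

namespace CoarseArrow

/-- The continuous extension of the second projection. -/
def src (a : CoarseArrow X) : Ultrafilter X := a.1.map Prod.snd

/-- The continuous extension of the first projection. -/
def rng (a : CoarseArrow X) : Ultrafilter X := a.1.map Prod.fst

/-- The pair `(x, y)` as an arrow of the coarse groupoid. -/
def pair (x y : X) : CoarseArrow X := ⟨pure (x, y), mem_coarseArrows.2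
  ⟨dist x y + 1, add_pos_of_nonneg_of_pos dist_nonneg one_pos,
    show dist x y ≤ dist x y + 1 from le_add_of_nonneg_right zero_le_one⟩⟩

/-- The unit at a point of the Stone-Čech compactification of `X`. -/
def unit (x : Ultrafilter X) : CoarseArrow X := ⟨x.map fun y => (y, y), mem_coarseArrows.2
  ⟨1, one_pos, Ultrafilter.mem_map.2 <| Filter.mem_of_superset Filter.univ_mem fun y _ => by
    simp [entourage]⟩⟩

/-- The inverse of an arrow. -/
def inv (a : CoarseArrow X) : CoarseArrow X := ⟨a.1.map Prod.swap, by
  obtain ⟨R, hR, h⟩ := mem_coarseArrows.1 a.2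
  refine mem_coarseArrows.2 ⟨R, hR, Ultrafilter.mem_map.2 <| Filter.mem_of_superset h fun p hp => ?_⟩
  simpa [entourage, dist_comm] using hp⟩

theorem exists_coloring [BoundedGeometry X] (R : ℝ) (hR : 0 < R) :
    ∃ (N : ℕ) (c : X → ℕ), (∀ x, c x ≤ N) ∧ ∀ x y, dist x y ≤ R → c x = c y → x = y := by
  classical
  obtain ⟨N, hN⟩ := BoundedGeometry.exists_card_ball (X := X) R hR
  have wf : WellFounded (WellOrderingRel : X → X → Prop) := IsWellFounded.wf
  let c : X → ℕ := wf.fix fun x ih =>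
    sInf {n | ∀ y (h : WellOrderingRel y x), dist y x ≤ R → n ≠ ih y h}
  have hc : ∀ x, c x = sInf {n | ∀ y, WellOrderingRel y x → dist y x ≤ R → n ≠ c y} := fun x =>
    wf.fix_eq _ x
  have key : ∀ x, ∃ n ≤ N, n ∈ {n | ∀ y, WellOrderingRel y x → dist y x ≤ R → n ≠ c y} := by
    intro x
    have hfin : (Metric.closedBall x R).Finite := Set.finite_of_encard_le_coe (hN x)
    have hcard : (hfin.toFinset.image c).card < (Finset.range (N + 1)).card := by
      have h := hN x
      rw [hfin.encard_eq_coe_toFinset_card] at h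
      have h' : hfin.toFinset.card ≤ N := by exact_mod_cast h
      rw [Finset.card_range]
      exact Nat.lt_succ_of_le (Finset.card_image_le.trans h')
    obtain ⟨n, hn, hn'⟩ := Finset.exists_mem_notMem_of_card_lt_card hcard
    refine ⟨n, Nat.lt_succ_iff.1 (Finset.mem_range.1 hn), fun y _ hy e => hn' ?_⟩
    exact Finset.mem_image.2 ⟨y, by simpa using hy, e.symm⟩
  have hmem : ∀ x, c x ∈ {n | ∀ y, WellOrderingRel y x → dist y x ≤ R → n ≠ c y} := by
    intro x
    rw [hc x]
    obtain ⟨n, -, hn⟩ := key x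
    exact Nat.sInf_mem ⟨n, hn⟩
  refine ⟨N, c, fun x => ?_, fun x y hxy e => ?_⟩
  · rw [hc x]
    obtain ⟨n, hn, hn'⟩ := key x
    exact (Nat.sInf_le hn').trans hn
  · rcases trichotomous_of WellOrderingRel x y with h | h | h
    · exact absurd e.symm (hmem y x h hxy)
    · exact h
    · exact absurd e (hmem x y h (by rwa [dist_comm]))

theorem exists_color {Y : Type*} (u : Ultrafilter Y) (c : Y → ℕ) (N : ℕ) (hc : ∀ y, c y ≤ N) :
    ∃ n, {y | c y = n} ∈ u := by
  have h : (⋃ n ∈ Set.Iic N, {y | c y = n}) ∈ u :=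
    Filter.mem_of_superset Filter.univ_mem fun y _ => by simpa using hc y
  rw [Ultrafilter.finite_biUnion_mem_iff (Set.finite_Iic N)] at h
  obtain ⟨n, -, hn⟩ := h
  exact ⟨n, hn⟩

theorem exists_graph {A : Set (X × X)} (hA : Set.InjOn Prod.snd A) :
    ∃ t : X → X, (∀ p ∈ A, (t p.2, p.2) = p) ∧ ∀ u : Ultrafilter (X × X), A ∈ u →
      (u.map Prod.snd).map (fun y => (t y, y)) = u := by
  classical
  have h1 : ∀ y, ∃ x, ∀ p ∈ A, p.2 = y → p.1 = x := by
    intro y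
    by_cases h : ∃ p ∈ A, p.2 = y
    · obtain ⟨p, hp, rfl⟩ := h
      exact ⟨p.1, fun q hq e => congrArg Prod.fst (hA hq hp e)⟩
    · exact ⟨y, fun p hp e => absurd ⟨p, hp, e⟩ h⟩
  choose t ht using h1
  have ht' : ∀ p ∈ A, (t p.2, p.2) = p := fun p hp => Prod.ext (ht p.2 p hp rfl).symm rfl
  refine ⟨t, ht', fun u hu => ?_⟩
  rw [Ultrafilter.map_map]
  refine Ultrafilter.coe_le_coe.1 fun s hs => Ultrafilter.mem_map.2 ?_
  exact Filter.mem_of_superset (Filter.inter_mem hu hs) fun p hp => by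
    change (t p.2, p.2) ∈ s
    rw [ht' p hp.1]
    exact hp.2

theorem exists_injOn [BoundedGeometry X] (a : CoarseArrow X) :
    ∃ A ∈ a.1, (∃ R > 0, A ⊆ entourage X R) ∧ Set.InjOn Prod.snd A := by
  obtain ⟨R, hR, h⟩ := mem_coarseArrows.1 a.2
  obtain ⟨N, c, hc, hinj⟩ := exists_coloring (X := X) (R + R) (add_pos hR hR)
  obtain ⟨n, hn⟩ := exists_color a.1 (fun p => c p.1) N fun p => hc _
  refine ⟨_, Filter.inter_mem h hn, ⟨R, hR, Set.inter_subset_left⟩, ?_⟩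
  rintro ⟨x, y⟩ ⟨hp, hp'⟩ ⟨x', y'⟩ ⟨hq, hq'⟩ e
  obtain rfl : y = y' := e
  have : x = x' := hinj x x' ((dist_triangle_right x x' y).trans (add_le_add hp hq))
    (Eq.trans hp' (Eq.symm hq'))
  rw [this]

theorem ext_src_rng [BoundedGeometry X] {a b : CoarseArrow X} (hs : src a = src b)
    (hr : rng a = rng b) : a = b := by
  obtain ⟨A, hA, ⟨R, hR, hAR⟩, hAi⟩ := exists_injOn a
  obtain ⟨B, hB, ⟨S, hS, hBS⟩, hBi⟩ := exists_injOn b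
  obtain ⟨t, ht, htu⟩ := exists_graph hAi
  obtain ⟨t', ht', htu'⟩ := exists_graph hBi
  have ha := htu a.1 hA
  have hb := htu' b.1 hB
  change (src a).map _ = _ at ha
  change (src b).map _ = _ at hb
  rw [← hs] at hb
  obtain ⟨N, c, hc, hinj⟩ := exists_coloring (X := X) (R + S) (add_pos hR hS)
  obtain ⟨n, hn⟩ := exists_color (rng a) c N hc
  have h1 : {y | (t y, y) ∈ A ∩ Prod.fst ⁻¹' {x | c x = n}} ∈ src a := by
    have : A ∩ Prod.fst ⁻¹' {x | c x = n} ∈ a.1 := Filter.inter_mem hA hn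
    rwa [← ha] at this
  have h2 : {y | (t' y, y) ∈ B ∩ Prod.fst ⁻¹' {x | c x = n}} ∈ src a := by
    rw [hr] at hn
    have : B ∩ Prod.fst ⁻¹' {x | c x = n} ∈ b.1 := Filter.inter_mem hB hn
    rwa [← hb] at this
  apply Subtype.ext
  rw [← ha, ← hb]
  refine Ultrafilter.coe_le_coe.1 fun s hs' => Ultrafilter.mem_map.2 ?_
  replace hs' := Ultrafilter.mem_map.1 hs'
  refine Filter.mem_of_superset (Filter.inter_mem (Filter.inter_mem h1 h2) hs') fun y hy => ?_
  have e : t y = t' y := by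
    refine hinj _ _ ?_ (Eq.trans hy.1.1.2 (Eq.symm hy.1.2.2))
    exact (dist_triangle_right _ _ y).trans (add_le_add (hAR hy.1.1.1) (hBS hy.1.2.1))
  change (t y, y) ∈ s
  rw [e]
  exact hy.2

/-- Composition of relations on `X`. -/
def compRel (A B : Set (X × X)) : Set (X × X) := {p | ∃ y, (p.1, y) ∈ A ∧ (y, p.2) ∈ B}

theorem exists_mul_mem [BoundedGeometry X] (a b : CoarseArrow X) (h : src a = rng b) :
    ∃ c : CoarseArrow X, (src c = src b ∧ rng c = rng a) ∧
      ∀ A ∈ a.1, ∀ B ∈ b.1, compRel A B ∈ c.1 := by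
  obtain ⟨A, hA, ⟨R, hR, hAR⟩, hAi⟩ := exists_injOn a
  obtain ⟨B, hB, ⟨S, hS, hBS⟩, hBi⟩ := exists_injOn b
  obtain ⟨t, ht, htu⟩ := exists_graph hAi
  obtain ⟨t', ht', htu'⟩ := exists_graph hBi
  have ha := htu a.1 hA
  have hb := htu' b.1 hB
  change (src a).map _ = _ at ha
  change (src b).map _ = _ at hb
  have hrb : rng b = (src b).map t' := by
    conv_lhs => rw [rng, ← hb, Ultrafilter.map_map]
    rfl
  have hra : rng a = (src a).map t := by
    conv_lhs => rw [rng, ← ha, Ultrafilter.map_map]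
    rfl
  let u : Ultrafilter (X × X) := (src b).map fun y => (t (t' y), y)
  have hu : ∀ A ∈ a.1, ∀ B ∈ b.1, compRel A B ∈ u := by
    intro A' hA' B' hB'
    have h1 : {y | (t (t' y), t' y) ∈ A'} ∈ src b := by
      rw [← ha, h, hrb] at hA'
      exact hA'
    have h2 : {y | (t' y, y) ∈ B'} ∈ src b := by
      rw [← hb] at hB'
      exact hB'
    exact Ultrafilter.mem_map.2 (Filter.mem_of_superset (Filter.inter_mem h1 h2)
      fun y hy => ⟨t' y, hy.1, hy.2⟩)
  refine ⟨⟨u, mem_coarseArrows.2 ⟨R + S, add_pos hR hS, ?_⟩⟩, ⟨?_, ?_⟩, hu⟩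
  · refine Filter.mem_of_superset (hu A hA B hB) ?_
    rintro ⟨x, z⟩ ⟨y, hxy, hyz⟩
    exact (dist_triangle x y z).trans (add_le_add (hAR hxy) (hBS hyz))
  · exact (Ultrafilter.map_map _ _ _).trans (Ultrafilter.map_id _)
  · rw [hra, h, hrb, Ultrafilter.map_map]
    exact Ultrafilter.map_map _ _ _

theorem exists_mul [BoundedGeometry X] (a b : CoarseArrow X) (h : src a = rng b) :
    ∃ c : CoarseArrow X, src c = src b ∧ rng c = rng a :=
  (exists_mul_mem a b h).imp fun _ hc => hc.1

/-- The product of composable arrows. Arrows are determined by their range and source, and the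
product is the arrow with the range of the first factor and the source of the second. -/
def mul [BoundedGeometry X] (a b : CoarseArrow X) (h : src a = rng b) : CoarseArrow X :=
  (exists_mul a b h).choose

theorem src_mul [BoundedGeometry X] (a b : CoarseArrow X) (h : src a = rng b) :
    src (mul a b h) = src b := (exists_mul a b h).choose_spec.1

theorem rng_mul [BoundedGeometry X] (a b : CoarseArrow X) (h : src a = rng b) :
    rng (mul a b h) = rng a := (exists_mul a b h).choose_spec.2

theorem compRel_mem_mul [BoundedGeometry X] (a b : CoarseArrow X) (h : src a = rng b)
    {A B : Set (X × X)} (hA : A ∈ a.1) (hB : B ∈ b.1) : compRel A B ∈ (mul a b h).1 := by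
  obtain ⟨c, ⟨h1, h2⟩, h3⟩ := exists_mul_mem a b h
  have : mul a b h = c := ext_src_rng (by rw [src_mul, h1]) (by rw [rng_mul, h2])
  rw [this]
  exact h3 A hA B hB

theorem src_unit (x : Ultrafilter X) : src (unit x) = x :=
  (Ultrafilter.map_map _ _ _).trans (Ultrafilter.map_id _)

theorem rng_unit (x : Ultrafilter X) : rng (unit x) = x :=
  (Ultrafilter.map_map _ _ _).trans (Ultrafilter.map_id _)

theorem src_inv (a : CoarseArrow X) : src (inv a) = rng a := Ultrafilter.map_map _ _ _

theorem rng_inv (a : CoarseArrow X) : rng (inv a) = src a := Ultrafilter.map_map _ _ _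

theorem continuous_map {Y Z : Type*} (f : Y → Z) :
    Continuous (Ultrafilter.map f : Ultrafilter Y → Ultrafilter Z) := by
  refine ultrafilterBasis_is_basis.continuous_iff.2 ?_
  rintro _ ⟨s, rfl⟩
  exact ultrafilter_isOpen_basic (f ⁻¹' s)

theorem isOpen_mem (A : Set (X × X)) : IsOpen {a : CoarseArrow X | A ∈ a.1} :=
  (ultrafilter_isOpen_basic A).preimage continuous_subtype_val

theorem exists_mem_of_nhds {a : CoarseArrow X} {V : Set (CoarseArrow X)} (hV : V ∈ nhds a) :
    ∃ A ∈ a.1, {b : CoarseArrow X | A ∈ b.1} ⊆ V := by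
  rw [nhds_subtype_eq_comap, Filter.mem_comap] at hV
  obtain ⟨W, hW, hWV⟩ := hV
  obtain ⟨_, ⟨A, rfl⟩, hA, hAW⟩ := ultrafilterBasis_is_basis.mem_nhds_iff.1 hW
  exact ⟨A, hA, fun b hb => hWV (hAW hb)⟩

theorem injOn_src {A : Set (X × X)} (hA : Set.InjOn Prod.snd A) :
    Set.InjOn (src : CoarseArrow X → Ultrafilter X) {a | A ∈ a.1} := by
  obtain ⟨t, -, ht⟩ := exists_graph hA
  intro a ha b hb e
  apply Subtype.ext
  rw [← ht a.1 ha, ← ht b.1 hb]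
  exact congrArg _ e

theorem isOpenMap_src [BoundedGeometry X] : IsOpenMap (src : CoarseArrow X → Ultrafilter X) := by
  refine IsOpenMap.of_nhds_le fun a V hV => ?_
  obtain ⟨B, hB, hBV⟩ := exists_mem_of_nhds hV
  obtain ⟨A, hA, ⟨R, hR, hAR⟩, hAi⟩ := exists_injOn a
  have hA'i : Set.InjOn Prod.snd (A ∩ B) := hAi.mono Set.inter_subset_left
  obtain ⟨t, ht, -⟩ := exists_graph hA'i
  have hopen : {x : Ultrafilter X | Prod.snd '' (A ∩ B) ∈ x} ∈ nhds (src a) :=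
    (ultrafilter_isOpen_basic _).mem_nhds (by
      refine Filter.mem_of_superset (Filter.inter_mem hA hB) fun p hp => ⟨p, hp, rfl⟩)
  refine Filter.mem_of_superset hopen fun x hx => ?_
  have hu : A ∩ B ∈ x.map fun y => (t y, y) := by
    refine Ultrafilter.mem_map.2 (Filter.mem_of_superset hx ?_)
    rintro _ ⟨p, hp, rfl⟩
    change (t p.2, p.2) ∈ A ∩ B
    rw [ht p hp]
    exact hp
  let b : CoarseArrow X := ⟨x.map fun y => (t y, y), mem_coarseArrows.2
    ⟨R, hR, Filter.mem_of_superset hu fun p hp => hAR hp.1⟩⟩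
  have hb : src b = x := (Ultrafilter.map_map _ _ _).trans (Ultrafilter.map_id _)
  rw [← hb]
  exact hBV (Filter.mem_of_superset hu Set.inter_subset_right)

theorem isLocalHomeomorph_src [BoundedGeometry X] :
    IsLocalHomeomorph (src : CoarseArrow X → Ultrafilter X) := by
  rw [isLocalHomeomorph_iff_isOpenEmbedding_restrict]
  intro a
  obtain ⟨A, hA, -, hAi⟩ := exists_injOn a
  refine ⟨_, (isOpen_mem A).mem_nhds hA, ?_⟩
  refine Topology.IsOpenEmbedding.of_continuous_injective_isOpenMap ?_ ?_ ?_
  · exact ((continuous_map Prod.snd).comp continuous_subtype_val).comp continuous_subtype_val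
  · exact (injOn_src hAi).injective
  · exact isOpenMap_src.comp (isOpen_mem A).isOpenMap_subtype_val

theorem injOn_compRel {A B : Set (X × X)} (hA : Set.InjOn Prod.snd A) (hB : Set.InjOn Prod.snd B) :
    Set.InjOn Prod.snd (compRel A B) := by
  rintro ⟨x, z⟩ ⟨y, hxy, hyz⟩ ⟨x', z'⟩ ⟨y', hxy', hyz'⟩ e
  obtain rfl : z = z' := e
  obtain rfl : y = y' := congrArg Prod.fst (hB hyz hyz' rfl)
  exact congrArg (fun w => (w, z)) (congrArg Prod.fst (hA hxy hxy' rfl))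

theorem continuous_mul [BoundedGeometry X] :
    Continuous fun p : {p : CoarseArrow X × CoarseArrow X // src p.1 = rng p.2} =>
      mul p.1.1 p.1.2 p.2 := by
  rw [continuous_iff_continuousAt]
  rintro ⟨⟨a, b⟩, h⟩
  obtain ⟨A, hA, -, hAi⟩ := exists_injOn a
  obtain ⟨B, hB, -, hBi⟩ := exists_injOn b
  intro V hV
  have hW : V ∩ {c | compRel A B ∈ c.1} ∈ nhds (mul a b h) :=
    Filter.inter_mem hV ((isOpen_mem _).mem_nhds (compRel_mem_mul a b h hA hB))
  have hS := isOpenMap_src.image_mem_nhds hW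
  rw [src_mul] at hS
  have c1 : Continuous fun p : {p : CoarseArrow X × CoarseArrow X // src p.1 = rng p.2} => p.1.1 :=
    continuous_fst.comp continuous_subtype_val
  have c2 : Continuous fun p : {p : CoarseArrow X × CoarseArrow X // src p.1 = rng p.2} => p.1.2 :=
    continuous_snd.comp continuous_subtype_val
  have e1 := ((isOpen_mem A).preimage c1).mem_nhds (x := ⟨(a, b), h⟩) hA
  have e2 := ((isOpen_mem B).preimage c2).mem_nhds (x := ⟨(a, b), h⟩) hB
  have e3 := (isLocalHomeomorph_src.continuous.comp c2).continuousAt (x := ⟨(a, b), h⟩)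
    |>.preimage_mem_nhds hS
  refine Filter.mem_map.2 (Filter.mem_of_superset (Filter.inter_mem (Filter.inter_mem e1 e2) e3) ?_)
  rintro p ⟨⟨h1, h2⟩, c, ⟨hcV, hcC⟩, hc⟩
  have : mul p.1.1 p.1.2 p.2 = c := by
    refine injOn_src (injOn_compRel hAi hBi) (compRel_mem_mul _ _ _ h1 h2) hcC ?_
    rw [src_mul]
    exact hc.symm
  change mul p.1.1 p.1.2 p.2 ∈ V
  rw [this]
  exact hcV

end CoarseArrow

open CoarseArrow in
variable (X) in
/-- The coarse groupoid of a metric space of bounded geometry. Its unit space is the Stone-Čech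
compactification of `X`, the space of ultrafilters on `X`. -/
def coarseGroupoid [BoundedGeometry X] : EtaleGroupoid (CoarseArrow X) (Ultrafilter X) where
  src := src
  rng := rng
  unit := unit
  inv := inv
  mul := mul
  src_unit := src_unit
  rng_unit := rng_unit
  src_inv := src_inv
  rng_inv := rng_inv
  src_mul := src_mul
  rng_mul := rng_mul
  mul_assoc a b c _ _ _ _ := ext_src_rng (by simp only [src_mul]) (by simp only [rng_mul])
  unit_mul a _ := ext_src_rng (src_mul _ _ _) (by rw [rng_mul, rng_unit])
  mul_unit a _ := ext_src_rng (by rw [src_mul, src_unit]) (rng_mul _ _ _)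
  inv_mul a _ := ext_src_rng (by rw [src_mul, src_unit]) (by rw [rng_mul, rng_inv, rng_unit])
  mul_inv a _ := ext_src_rng (by rw [src_mul, src_inv, src_unit]) (by rw [rng_mul, rng_unit])
  t2 := inferInstance
  locallyCompact := Topology.IsInducing.subtypeVal.locallyCompactSpace
    (by rw [Subtype.range_val]; exact isOpen_coarseArrows.isLocallyClosed)
  continuous_unit := (continuous_map _).subtype_mk _
  continuous_inv := ((continuous_map _).comp continuous_subtype_val).subtype_mk _
  continuous_mul := continuous_mul
  isLocalHomeomorph_src := isLocalHomeomorph_src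

/-! ### The uniform Roe algebra, geometric and ghostly ideals -/

/-- An operator has finite propagation if its matrix is supported in some entourage. -/
def FinitePropagation (T : BOp X) : Prop := ∃ R : ℝ, ∀ x y, coeff T x y ≠ 0 → dist x y ≤ R

variable (X) in
/-- The algebraic uniform Roe algebra, the operators of finite propagation. -/
def algebraicUniformRoe : StarSubalgebra ℂ (BOp X) where
  carrier := {T | FinitePropagation T}
  mul_mem' := by
    rintro T S ⟨R, hR⟩ ⟨R', hR'⟩
    refine ⟨R + R', fun x z h => ?_⟩
    by_contra hn
    apply h
    have hs := hasSum_coeff_mul T S x z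
    have h0 : (fun y => coeff T x y * coeff S y z) = fun _ => 0 := by
      ext y
      by_contra hy
      exact hn ((dist_triangle x y z).trans
        (add_le_add (hR x y (left_ne_zero_of_mul hy)) (hR' y z (right_ne_zero_of_mul hy))))
    rw [h0] at hs
    exact hs.unique hasSum_zero
  add_mem' := by
    rintro T S ⟨R, hR⟩ ⟨R', hR'⟩
    refine ⟨max R R', fun x y h => ?_⟩
    by_contra hn
    rw [not_le, max_lt_iff] at hn
    apply h
    rw [coeff_add, not_imp_comm.1 (hR x y) hn.1.not_ge, not_imp_comm.1 (hR' x y) hn.2.not_ge,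
      add_zero]
  algebraMap_mem' := by
    intro c
    refine ⟨0, fun x y h => ?_⟩
    by_contra hn
    apply h
    rw [Algebra.algebraMap_eq_smul_one, coeff_smul, coeff_one_of_ne, mul_zero]
    rintro rfl
    simp at hn
  star_mem' := by
    rintro T ⟨R, hR⟩
    refine ⟨R, fun x y h => ?_⟩
    rw [dist_comm]
    refine hR y x fun h0 => h ?_
    rw [coeff_star, h0, map_zero]

variable (X) in
/-- The uniform Roe algebra, the norm closure of the operators of finite propagation. -/
def uniformRoe : StarSubalgebra ℂ (BOp X) := (algebraicUniformRoe X).topologicalClosure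

variable [BoundedGeometry X]

/-- A map from the reduced C*-algebra of the coarse groupoid to the uniform Roe algebra extends the
canonical map on compactly supported functions if it sends `f` to the operator with matrix
`(f(x, y))`. -/
def ExtendsCanonical (Θ : (coarseGroupoid X).reducedCStar → uniformRoe X) : Prop :=
  ∀ (f : C_c(CoarseArrow X, ℂ)) (x y : X),
    coeff (Θ ((coarseGroupoid X).ofCc f) : BOp X) x y = f (CoarseArrow.pair x y)

/-- The geometric ideal associated to `U`: the closure in the uniform Roe algebra of the operators
given by the compactly supported functions on the coarse groupoid that vanish at all arrows with
source outside `U`. -/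
def geometricIdeal (U : Set (Ultrafilter X)) : Set (uniformRoe X) :=
  closure {T | ∃ f : C_c(CoarseArrow X, ℂ), (∀ a, CoarseArrow.src a ∉ U → f a = 0) ∧
    ∀ x y, coeff (T : BOp X) x y = f (CoarseArrow.pair x y)}

/-- The ghostly ideal associated to `U`: the operators `T` in the uniform Roe algebra such that for
all `ε > 0` the set of all `x` with `ε ≤ |T(x, y)|` for some `y` has its closure in `U`. -/
def ghostlyIdeal (U : Set (Ultrafilter X)) : Set (uniformRoe X) :=
  {T | ∀ ε > 0, closure ((pure : X → Ultrafilter X) ''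
    {x | ∃ y, ε ≤ ‖coeff (T : BOp X) x y‖}) ⊆ U}

end Coarse

end CoarseIdeals

end

open CoarseIdeals

noncomputable section

namespace CoarseIdeals

/-! ### Ranges of star homomorphisms -/

section StarHom

variable {A B : Type*} [NonUnitalCStarAlgebra A] [NonUnitalCStarAlgebra B]

open scoped CStarAlgebra

/-! Every element `T` of the reduced algebra of an étale groupoid is encoded by one continuous
function `symb T` on the arrows: the matrix coefficient of `T` at `(a, b)` is the value of `symb T`
at `a * b⁻¹`. This holds for `reg f`, where the function is `f`, and passes to norm limits
(`coeff_eq_kern_symb`). Hence `q_U T = 0` means exactly that `symb T` vanishes on the arrows over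
the complement of `U`.

For the coarse groupoid the pairs `(x, y)` are dense in the arrows, and the arrows with principal
source `z` are the pairs `(x, z)`. The regular representation on that fibre therefore acts on
square-summable functions on `X` with matrix `symb T (x, y)`, whatever `z` is. Density makes it
injective. Its range is the uniform Roe algebra (`range_rep`): compactly supported functions give
finite propagation, every matrix of finite propagation extends continuously to the groupoid, and
ranges of star homomorphisms are closed. Uniqueness holds because the convolution algebra is dense.

The kernel of `q_U` is the ghostly ideal (`ExtendsCanonical.mem_ghostlyIdeal_iff`). A nonzero value
of `symb T` at an arrow persists on nearby pairs and puts the range of the arrow in one of the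
closures defining the ideal; conversely, each ultrafilter in such a closure is the range of an arrow
at which `symb T` is nonzero. Invariance of `U` lets range and source be exchanged.

The range of `i_U` is the geometric ideal. The definitions differ, since a function vanishing off
the part over `U` need not have compact support inside it, but soft thresholding shows that the
closures agree (`closure_range_extendCc`). Injectivity of `i_U` and surjectivity of `q_U` always
hold, the latter by the Tietze extension theorem, so exactness is the equality of range and kernel.
-/

theorem exists_preimage_norm_le_of_isSelfAdjoint (φ : A →⋆ₙₐ[ℂ] B) {a : A}
    (ha : IsSelfAdjoint a) : ∃ a', φ a' = φ a ∧ ‖a'‖ ≤ ‖φ a‖ := by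
  set r := ‖φ a‖ with hr
  have hr0 : 0 ≤ r := norm_nonneg _
  have hφa : IsSelfAdjoint (φ a) := ha.map φ
  let f : ℝ → ℝ := fun x => max (-r) (min r x)
  have hf : Continuous f := by fun_prop
  have hf0 : f 0 = 0 := by simp [f, hr0]
  -- The preimage is `a` with its spectrum truncated to `[-r, r]`. Since the spectrum of `φ a`
  -- already lies there, truncation does not change the image.
  refine ⟨cfcₙ f a, ?_, norm_cfcₙ_le fun x _ => ?_⟩
  · rw [NonUnitalStarAlgHom.map_cfcₙ φ f a hf.continuousOn hf0 (map_continuous φ) ha hφa]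
    conv_rhs => rw [← cfcₙ_id ℝ (φ a) hφa]
    refine cfcₙ_congr fun x hx => ?_
    have hx' : |x| ≤ r := by
      have := norm_apply_le_norm_cfcₙ (id : ℝ → ℝ) (φ a) hx continuousOn_id rfl hφa
      rwa [cfcₙ_id ℝ (φ a) hφa] at this
    obtain ⟨h1, h2⟩ := abs_le.1 hx'
    simp [f, h1, h2]
  · rw [Real.norm_eq_abs, abs_le]
    exact ⟨le_max_left _ _, max_le (by linarith) (min_le_left _ _)⟩

/-- The real and imaginary parts are lifted separately, each at the cost of `‖φ a‖`; this is the
source of the factor 2. -/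
theorem exists_preimage_norm_le (φ : A →⋆ₙₐ[ℂ] B) (a : A) :
    ∃ a', φ a' = φ a ∧ ‖a'‖ ≤ 2 * ‖φ a‖ := by
  obtain ⟨h, hh, hh'⟩ := exists_preimage_norm_le_of_isSelfAdjoint φ (realPart a).2
  obtain ⟨k, hk, hk'⟩ := exists_preimage_norm_le_of_isSelfAdjoint φ (imaginaryPart a).2
  have hs : ∀ x, φ ((2⁻¹ : ℝ) • x) = (2⁻¹ : ℝ) • φ x := map_real_smul φ (map_continuous φ) _
  have e1 : ‖φ (realPart a : A)‖ ≤ ‖φ a‖ := by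
    have : φ (realPart a : A) = (realPart (φ a) : B) := by
      simp [realPart_apply_coe, hs, map_star]
    rw [this]
    exact realPart.norm_le (φ a)
  have e2 : ‖φ (imaginaryPart a : A)‖ ≤ ‖φ a‖ := by
    have : φ (imaginaryPart a : A) = (imaginaryPart (φ a) : B) := by
      simp [imaginaryPart_apply_coe, hs, map_star]
    rw [this]
    exact imaginaryPart.norm_le (φ a)
  refine ⟨h + Complex.I • k, ?_, ?_⟩
  · rw [map_add, map_smul, hh, hk, ← map_smul, ← map_add, realPart_add_I_smul_imaginaryPart]
  · refine (norm_add_le _ _).trans ?_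
    rw [norm_smul, Complex.norm_I, one_mul]
    linarith

/-- A star homomorphism of C*-algebras has closed range. -/
theorem isClosed_range_starHom (φ : A →⋆ₙₐ[ℂ] B) : IsClosed (Set.range φ) := by
  let f : NormedAddGroupHom A B :=
    { toFun := φ
      map_add' := map_add φ
      bound' := ⟨1, fun a => by rw [one_mul]; exact NonUnitalStarAlgHom.norm_apply_le φ a⟩ }
  have h : f.SurjectiveOnWith f.range 2 := by
    intro b hb
    obtain ⟨a, rfl⟩ := (f.mem_range b).1 hb
    exact exists_preimage_norm_le φ a
  -- A point of the closure is a rapidly convergent series of elements of the range. Their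
  -- controlled preimages form a convergent series in the complete algebra `A`.
  have h' := controlled_closure_of_complete two_pos one_pos h
  refine isClosed_of_closure_subset fun b hb => ?_
  obtain ⟨a, ha, -⟩ := h' b hb
  exact ⟨a, ha⟩

end StarHom

/-! ### Norm bounds and continuity for matrix coefficients. -/

theorem norm_delta {ι : Type*} (i : ι) : ‖(delta i : Ell2 ι)‖ = 1 := by
  simp [delta]

theorem norm_coeff_le {ι κ : Type*} (T : Ell2 ι →L[ℂ] Ell2 κ) (x : κ) (y : ι) :
    ‖coeff T x y‖ ≤ ‖T‖ := by
  refine (lp.norm_apply_le_norm (by norm_num) (T (delta y)) x).trans ?_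
  simpa [norm_delta] using T.le_opNorm (delta y)

theorem continuous_coeff {ι κ : Type*} (x : κ) (y : ι) :
    Continuous fun T : Ell2 ι →L[ℂ] Ell2 κ => coeff T x y := by
  have h : Continuous fun T : Ell2 ι →L[ℂ] Ell2 κ => ⟪delta x, T (delta y)⟫_ℂ := by fun_prop
  exact h.congr fun T => inner_delta x _

theorem IsBandKernel.norm_op_le {ι : Type*} {k : ι → ι → ℂ} {N : ℕ} {M : ℝ}
    (hk : IsBandKernel k N M) : ‖hk.op‖ ≤ N * M :=
  LinearMap.mkContinuous_norm_le _ (mul_nonneg (Nat.cast_nonneg _) hk.nonneg) _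

/-! ### Elements of the reduced algebra as continuous functions, and the maps `i_U` and `q_U`. -/

namespace EtaleGroupoid

variable {G B : Type*} [TopologicalSpace G] [TopologicalSpace B] (𝒢 : EtaleGroupoid G B)

/-- Closedness supplies completeness, so that the subalgebra is a C*-algebra in its own right and
the results on star homomorphisms apply to it. -/
instance isClosed_reducedCStar : IsClosed (𝒢.reducedCStar : Set (BOp G)) :=
  NonUnitalStarSubalgebra.isClosed_topologicalClosure _

theorem dense_range_ofCc : DenseRange 𝒢.ofCc := by
  intro T
  rw [closure_subtype]
  have : (T : BOp G) ∈ closure (Set.range 𝒢.reg) := T.2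
  rwa [← Set.range_comp]

/-- The function on the groupoid that represents an element of the reduced C*-algebra. -/
def symb (T : BOp G) (a : G) : ℂ := coeff T a (𝒢.unit (𝒢.src a))

theorem div_unit (a : G) (h : 𝒢.src a = 𝒢.src (𝒢.unit (𝒢.src a))) :
    𝒢.div a (𝒢.unit (𝒢.src a)) h = a := by
  have e := 𝒢.div_mul a (𝒢.unit (𝒢.src a)) h (by rw [𝒢.src_div])
  rwa [𝒢.mul_unit'] at e

theorem symb_reg (f : C_c(G, ℂ)) : 𝒢.symb (𝒢.reg f) = f := by
  ext a
  rw [symb, coeff_reg, 𝒢.kern_of_eq _ (𝒢.src_unit _).symm, div_unit]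

theorem continuous_symb_apply (a : G) : Continuous fun T => 𝒢.symb T a := continuous_coeff _ _

theorem norm_symb_sub_le (T S : BOp G) (a : G) : ‖𝒢.symb T a - 𝒢.symb S a‖ ≤ ‖T - S‖ :=
  norm_coeff_le (T - S) _ _

/-- For fixed `a` and `b` both sides are norm continuous in `T` and agree on every `reg f`. Thus the
columns at units determine the whole operator. -/
theorem coeff_eq_kern_symb {T : BOp G} (hT : T ∈ 𝒢.reducedCStar) (a b : G) :
    coeff T a b = 𝒢.kern (𝒢.symb T) a b := by
  have hcl : T ∈ closure (Set.range 𝒢.reg) := hT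
  refine closure_minimal (t := {T | coeff T a b = 𝒢.kern (𝒢.symb T) a b}) ?_ ?_ hcl
  · rintro _ ⟨f, rfl⟩
    rw [Set.mem_ofPred_eq, symb_reg, coeff_reg]
  · refine isClosed_eq (continuous_coeff a b) ?_
    by_cases h : 𝒢.src a = 𝒢.src b
    · simp only [𝒢.kern_of_eq _ h]
      exact 𝒢.continuous_symb_apply _
    · simp only [𝒢.kern_of_ne _ h]
      exact continuous_const

theorem exists_norm_sub_reg_lt {T : BOp G} (hT : T ∈ 𝒢.reducedCStar) {ε : ℝ} (hε : 0 < ε) :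
    ∃ f : C_c(G, ℂ), ‖T - 𝒢.reg f‖ < ε := by
  have hcl : T ∈ closure (Set.range 𝒢.reg) := hT
  obtain ⟨_, ⟨f, rfl⟩, h⟩ := Metric.mem_closure_iff.1 hcl ε hε
  exact ⟨f, by rwa [dist_eq_norm] at h⟩

/-- Coefficients are bounded by the operator norm, so `symb T` is a uniform limit of compactly
supported continuous functions. -/
theorem continuous_symb {T : BOp G} (hT : T ∈ 𝒢.reducedCStar) : Continuous (𝒢.symb T) := by
  refine continuous_of_uniform_approx_of_continuous fun u hu => ?_
  obtain ⟨ε, hε, h⟩ := Metric.mem_uniformity_dist.1 hu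
  obtain ⟨f, hf⟩ := 𝒢.exists_norm_sub_reg_lt hT hε
  refine ⟨f, f.continuous, fun a => h ?_⟩
  rw [dist_eq_norm, ← 𝒢.symb_reg f]
  exact (𝒢.norm_symb_sub_le _ _ _).trans_lt hf

theorem eq_zero_of_symb_eq_zero {T : BOp G} (hT : T ∈ 𝒢.reducedCStar) (h : 𝒢.symb T = 0) :
    T = 0 := by
  refine op_ext fun a b => ?_
  rw [𝒢.coeff_eq_kern_symb hT, h, coeff_zero]
  by_cases e : 𝒢.src a = 𝒢.src b
  · rw [𝒢.kern_of_eq _ e]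
    rfl
  · rw [𝒢.kern_of_ne _ e]

theorem compress_eq_zero_iff (Y : Set B) {T : BOp G} (hT : T ∈ 𝒢.reducedCStar)
    (hY : 𝒢.IsInvariant Y) :
    𝒢.compress Y T = 0 ↔ ∀ a, 𝒢.src a ∈ Y → 𝒢.symb T a = 0 := by
  refine ⟨fun h a ha => ?_, fun h => op_ext fun a b => ?_⟩
  · have := 𝒢.coeff_compress Y T ⟨a, ha⟩ ⟨𝒢.unit (𝒢.src a), by rwa [𝒢.src_unit]⟩
    rw [h, coeff_zero] at this
    exact this.symm
  · rw [coeff_compress, 𝒢.coeff_eq_kern_symb hT, coeff_zero]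
    by_cases e : 𝒢.src a = 𝒢.src b
    · rw [𝒢.kern_of_eq _ e]
      -- The arrow `a * b⁻¹` has source `rng b`, which lies in `Y` by invariance.
      refine h _ ?_
      rw [𝒢.src_div, hY.mem_iff]
      exact b.2
    · rw [𝒢.kern_of_ne _ e]

theorem restrictionHom_eq_zero_iff (Y : Set B) (hY : 𝒢.IsInvariant Y) (hc : IsClosed Y)
    (T : 𝒢.reducedCStar) :
    𝒢.restrictionHom Y hY hc T = 0 ↔ ∀ a, 𝒢.src a ∈ Y → 𝒢.symb (T : BOp G) a = 0 := by
  rw [← 𝒢.compress_eq_zero_iff Y T.2 hY, Subtype.ext_iff]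
  rfl

theorem inclusionHom_injective (Y : Set B) (hY : 𝒢.IsInvariant Y) (ho : IsOpen Y) :
    Function.Injective (𝒢.inclusionHom Y hY ho) := by
  intro T S h
  have h' : 𝒢.inflate Y (T : BOp (𝒢.Arrows Y)) = 𝒢.inflate Y S := congrArg Subtype.val h
  refine Subtype.ext (op_ext fun a b => ?_)
  rw [← 𝒢.coeff_inflate Y, h', 𝒢.coeff_inflate Y]

/-- An injective star homomorphism is isometric, and an isometry from a complete space maps closures
onto closures. -/
theorem range_inclusionHom (Y : Set B) (hY : 𝒢.IsInvariant Y) (ho : IsOpen Y) :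
    Set.range (𝒢.inclusionHom Y hY ho) =
      closure (Set.range fun f : C_c(𝒢.Arrows Y, ℂ) => 𝒢.ofCc (𝒢.extendCc Y ho f)) := by
  set φ := 𝒢.inclusionHom Y hY ho
  have hd := (𝒢.reduction Y hY ho.isLocallyClosed).dense_range_ofCc
  have hφ := NonUnitalStarAlgHom.isometry φ (𝒢.inclusionHom_injective Y hY ho)
  have e : (Set.range fun f : C_c(𝒢.Arrows Y, ℂ) => 𝒢.ofCc (𝒢.extendCc Y ho f)) =
      φ '' Set.range (𝒢.reduction Y hY ho.isLocallyClosed).ofCc := by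
    rw [← Set.range_comp]
    exact congrArg Set.range (funext fun f => (𝒢.inclusionHom_ofCc Y hY ho f).symm)
  rw [e, hφ.isClosedEmbedding.closure_image_eq, hd.closure_range, Set.image_univ]

/-- The range is closed, and it contains the dense image of the convolution algebra as soon as
restriction of functions is onto. -/
theorem restrictionHom_surjective (Y : Set B) (hY : 𝒢.IsInvariant Y) (hc : IsClosed Y)
    (h : Function.Surjective (𝒢.restrictCc Y hc)) :
    Function.Surjective (𝒢.restrictionHom Y hY hc) := by
  have hcl := isClosed_range_starHom (𝒢.restrictionHom Y hY hc)
  have hd := (𝒢.reduction Y hY hc.isLocallyClosed).dense_range_ofCc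
  rw [← Set.range_eq_univ, Set.eq_univ_iff_forall]
  intro T
  refine closure_minimal ?_ hcl (hd T)
  rintro _ ⟨f, rfl⟩
  obtain ⟨g, rfl⟩ := h f
  exact ⟨𝒢.ofCc g, 𝒢.restrictionHom_ofCc Y hY hc g⟩

/-! ### Thresholding functions that vanish off an open invariant set. -/

theorem norm_reg_le {f : C_c(G, ℂ)} {k : G → ℂ} {N : ℕ} {M ε : ℝ}
    (hk : IsBandKernel (𝒢.kern k) N M) (hε : 0 ≤ ε) (hf : ∀ a, ‖f a‖ ≤ ε)
    (hfk : ∀ a, k a = 0 → f a = 0) : ‖𝒢.reg f‖ ≤ N * ε := by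
  have hs : ∀ a b, 𝒢.kern f a b ≠ 0 → 𝒢.kern k a b ≠ 0 := by
    intro a b h h'
    by_cases e : 𝒢.src a = 𝒢.src b
    · rw [𝒢.kern_of_eq _ e] at h h'
      exact h (hfk _ h')
    · exact h (𝒢.kern_of_ne _ e)
  -- The count `N` of nonzero entries is inherited from `k`, while the entry bound is the uniform
  -- bound `ε` of `f`. On a fixed support, the uniform norm thus controls the reduced norm.
  have hb : IsBandKernel (𝒢.kern f) N ε :=
    { nonneg := hε
      row := fun x => (Set.encard_le_encard fun y hy => hs x y hy).trans (hk.row x)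
      col := fun y => (Set.encard_le_encard fun x hx => hs x y hx).trans (hk.col y)
      bound := fun a b => by
        by_cases e : 𝒢.src a = 𝒢.src b
        · rw [𝒢.kern_of_eq _ e]
          exact hf _
        · rw [𝒢.kern_of_ne _ e, norm_zero]
          exact hε }
  have : 𝒢.reg f = hb.op := op_ext fun a b => by rw [coeff_reg, hb.coeff_op]
  rw [this]
  exact hb.norm_op_le

/-- The soft threshold at level `ε`, which shrinks the absolute value by `ε`. -/
def threshold (ε : ℝ) (z : ℂ) : ℂ := z * ((1 - ε / max ε ‖z‖ : ℝ) : ℂ)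

theorem continuous_threshold {ε : ℝ} (hε : 0 < ε) : Continuous (threshold ε) := by
  unfold threshold
  refine continuous_id.mul (Complex.continuous_ofReal.comp ?_)
  refine continuous_const.sub (continuous_const.div (by fun_prop) fun z => ?_)
  exact (lt_max_of_lt_left hε).ne'

theorem threshold_of_le {ε : ℝ} (hε : 0 < ε) {z : ℂ} (hz : ‖z‖ ≤ ε) : threshold ε z = 0 := by
  rw [threshold, max_eq_left hz, div_self hε.ne', sub_self, Complex.ofReal_zero, mul_zero]

theorem norm_sub_threshold_le {ε : ℝ} (hε : 0 < ε) (z : ℂ) : ‖z - threshold ε z‖ ≤ ε := by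
  have : z - threshold ε z = z * ((ε / max ε ‖z‖ : ℝ) : ℂ) := by
    rw [threshold]
    push_cast
    ring
  have hm : 0 < max ε ‖z‖ := lt_max_of_lt_left hε
  rw [this, norm_mul, Complex.norm_real, Real.norm_of_nonneg (by positivity), mul_div_assoc',
    div_le_iff₀ hm, mul_comm]
  exact mul_le_mul_of_nonneg_left (le_max_right _ _) hε.le

/-- The support of `f` may reach the boundary of the part over `Y`, but the set where `ε ≤ ‖f‖` is
compact inside it. Thresholding at `ε` moves the support into that set and changes `f` by at most
`ε` without enlarging its support. -/
theorem exists_extendCc_near (Y : Set B) (ho : IsOpen Y) (f : C_c(G, ℂ))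
    (hf : ∀ a, 𝒢.src a ∉ Y → f a = 0) {δ : ℝ} (hδ : 0 < δ) :
    ∃ g : C_c(𝒢.Arrows Y, ℂ), ‖𝒢.reg f - 𝒢.reg (𝒢.extendCc Y ho g)‖ < δ := by
  obtain ⟨N, M, hk⟩ := 𝒢.exists_band f
  -- Chosen so that the bound `N * ε` from `norm_reg_le` is strictly below `δ`, also when `N = 0`.
  set ε : ℝ := δ / (N + 1)
  have hε : 0 < ε := by positivity
  have hK : IsCompact {a | ε ≤ ‖f a‖} :=
    f.hasCompactSupport.isCompact.of_isClosed_subset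
      (isClosed_le continuous_const f.continuous.norm) fun a ha => subset_tsupport _ fun h0 => by
        rw [Set.mem_ofPred_eq, h0, norm_zero] at ha
        linarith
  have hK' : IsCompact {a : 𝒢.Arrows Y | ε ≤ ‖f a‖} := by
    refine (Topology.IsInducing.subtypeVal (t := 𝒢.src ⁻¹' Y)).isCompact_iff.2 ?_
    convert hK using 1
    ext a
    refine ⟨?_, fun ha => ?_⟩
    · rintro ⟨b, hb, rfl⟩
      exact hb
    · refine ⟨⟨a, ?_⟩, ha, rfl⟩
      by_contra hn
      rw [Set.mem_ofPred_eq, hf a hn, norm_zero] at ha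
      linarith
  have := 𝒢.t2_arrows Y
  let g : C_c(𝒢.Arrows Y, ℂ) :=
    { toFun := fun a => threshold ε (f a)
      continuous_toFun := (continuous_threshold hε).comp (f.continuous.comp continuous_subtype_val)
      hasCompactSupport' := HasCompactSupport.intro hK' fun a ha =>
        threshold_of_le hε (not_le.1 ha).le }
  have hg : ∀ a, 𝒢.extendCc Y ho g a = threshold ε (f a) := by
    intro a
    by_cases ha : 𝒢.src a ∈ Y
    · exact 𝒢.extendCc_apply Y ho g ⟨a, ha⟩
    · rw [𝒢.extendCc_apply_of_not Y ho g ha, hf a ha, threshold, zero_mul]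
  refine ⟨g, ?_⟩
  have e : 𝒢.reg f - 𝒢.reg (𝒢.extendCc Y ho g) = 𝒢.reg (f - 𝒢.extendCc Y ho g) := by
    rw [sub_eq_iff_eq_add, ← reg_add, sub_add_cancel]
  rw [e]
  refine (𝒢.norm_reg_le hk hε.le (fun a => ?_) fun a ha => ?_).trans_lt ?_
  · change ‖f a - 𝒢.extendCc Y ho g a‖ ≤ ε
    rw [hg]
    exact norm_sub_threshold_le hε _
  · change f a - 𝒢.extendCc Y ho g a = 0
    rw [hg, ha, threshold, zero_mul, sub_zero]
  · have : ((N : ℝ) + 1) * ε = δ := mul_div_cancel₀ _ (by positivity)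
    linarith

/-- This reconciles the two descriptions of the ideal over `Y`: compact support inside the
reduction, as in the range of `i_U`, and mere vanishing outside it, as in `geometricIdeal`. -/
theorem closure_range_extendCc (Y : Set B) (ho : IsOpen Y) :
    closure (Set.range fun f : C_c(𝒢.Arrows Y, ℂ) => 𝒢.ofCc (𝒢.extendCc Y ho f)) =
      closure (𝒢.ofCc '' {f | ∀ a, 𝒢.src a ∉ Y → f a = 0}) := by
  refine subset_antisymm (closure_mono ?_) (closure_minimal ?_ isClosed_closure)
  · rintro _ ⟨f, rfl⟩
    exact ⟨_, fun a ha => 𝒢.extendCc_apply_of_not Y ho f ha, rfl⟩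
  · rintro _ ⟨f, hf, rfl⟩
    refine Metric.mem_closure_iff.2 fun δ hδ => ?_
    obtain ⟨g, hg⟩ := 𝒢.exists_extendCc_near Y ho f hf hδ
    refine ⟨_, ⟨g, rfl⟩, ?_⟩
    rw [dist_eq_norm]
    exact hg

end EtaleGroupoid

/-! ### Pulling back along an injection -/

section Pullback

variable {ι κ : Type*} (e : ι ↪ κ)

/-- Composition of square-summable functions with an injection. -/
def pullback : Ell2 κ →L[ℂ] Ell2 ι :=
  have key : ∀ (ξ : Ell2 κ) (s : Finset ι),
      ∑ i ∈ s, ‖(ξ : κ → ℂ) (e i)‖ ^ ENNReal.toReal 2 ≤ ‖ξ‖ ^ ENNReal.toReal 2 := fun ξ s => by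
    have := lp.sum_rpow_le_norm_rpow (p := 2) (by norm_num) ξ (s.map e)
    rwa [Finset.sum_map] at this
  LinearMap.mkContinuous
    { toFun := fun ξ => ⟨fun i => (ξ : κ → ℂ) (e i), memℓp_gen' (key ξ)⟩
      map_add' := fun _ _ => rfl
      map_smul' := fun _ _ => rfl }
    1
    fun ξ => by
      rw [one_mul]
      exact lp.norm_le_of_forall_sum_le (by norm_num) (norm_nonneg _) (key ξ)

theorem pullback_apply (ξ : Ell2 κ) (i : ι) :
    (pullback e ξ : ι → ℂ) i = (ξ : κ → ℂ) (e i) := rfl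

theorem adjoint_pullback_delta (i : ι) :
    ContinuousLinearMap.adjoint (pullback e) (delta i) = delta (e i) := by
  refine ext_inner_right ℂ fun ξ => ?_
  rw [ContinuousLinearMap.adjoint_inner_left, inner_delta, inner_delta, pullback_apply]

/-- Compression of operators along an injection of index sets. -/
def pullbackOp (T : BOp κ) : BOp ι :=
  (pullback e).comp (T.comp (ContinuousLinearMap.adjoint (pullback e)))

theorem coeff_pullbackOp (T : BOp κ) (x y : ι) :
    coeff (pullbackOp e T) x y = coeff T (e x) (e y) := by
  simp only [coeff, pullbackOp, ContinuousLinearMap.comp_apply, pullback_apply]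
  rw [adjoint_pullback_delta]

/-- A compression is not multiplicative in general. Here the rows of `T` indexed by the range of `e`
vanish off that range, so the sum for a coefficient of `T * S` loses nothing when restricted to it.
-/
theorem pullbackOp_mul {T : BOp κ} (hT : ∀ x b, b ∉ Set.range e → coeff T (e x) b = 0)
    (S : BOp κ) : pullbackOp e (T * S) = pullbackOp e T * pullbackOp e S := by
  refine op_ext fun x z => ?_
  have h1 := hasSum_coeff_mul T S (e x) (e z)
  rw [← e.injective.hasSum_iff fun b hb => by rw [hT x b hb, zero_mul]] at h1
  have h2 := hasSum_coeff_mul (pullbackOp e T) (pullbackOp e S) x z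
  simp only [coeff_pullbackOp] at h2
  rw [coeff_pullbackOp]
  exact h1.unique h2

end Pullback

/-! ### Density of pairs, compactness and extension of functions on the coarse groupoid. -/

namespace CoarseArrow

variable {X : Type*} [MetricSpace X]

/-- An ultrafilter on `X × X`, viewed as a filter, converges to itself as a point. This is density
of the pairs in usable form: a continuous function at `a` is the limit along `a` of its values at
pairs. -/
theorem tendsto_pair (a : CoarseArrow X) :
    Filter.Tendsto (fun p : X × X => pair p.1 p.2) a.1 (nhds a) := by
  intro V hV
  obtain ⟨A, hA, hAV⟩ := exists_mem_of_nhds hV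
  exact Filter.mem_of_superset hA fun p hp => hAV hp

theorem isClosed_mem (A : Set (X × X)) : IsClosed {a : CoarseArrow X | A ∈ a.1} :=
  (ultrafilter_isClosed_basic A).preimage continuous_subtype_val

theorem isCompact_mem_entourage {R : ℝ} (hR : 0 < R) :
    IsCompact {a : CoarseArrow X | entourage X R ∈ a.1} := by
  refine (Topology.IsInducing.subtypeVal (t := coarseArrows X)).isCompact_iff.2 ?_
  convert (ultrafilter_isClosed_basic (entourage X R)).isCompact using 1
  ext u
  refine ⟨?_, fun hu => ⟨⟨u, mem_coarseArrows.2 ⟨R, hR, hu⟩⟩, hu, rfl⟩⟩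
  rintro ⟨a, ha, rfl⟩
  exact ha

theorem entourage_mono {R S : ℝ} (h : R ≤ S) : entourage X R ⊆ entourage X S :=
  fun _ hp => le_trans hp h

theorem exists_entourage_of_isCompact {K : Set (CoarseArrow X)} (hK : IsCompact K) :
    ∃ R > 0, ∀ a ∈ K, entourage X R ∈ a.1 := by
  -- The closures of the entourages are open and increase with `R`, so a single one covers `K`.
  obtain ⟨R, hR⟩ := hK.elim_directed_cover (fun R : ℝ => {a : CoarseArrow X | entourage X R ∈ a.1})
    (fun R => isOpen_mem _)
    (fun a _ => by
      obtain ⟨R, -, h⟩ := mem_coarseArrows.1 a.2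
      exact Set.mem_iUnion.2 ⟨R, h⟩)
    (directed_of_isDirected_le fun R S h a ha => Filter.mem_of_superset ha (entourage_mono h))
  exact ⟨max R 1, by positivity, fun a ha =>
    Filter.mem_of_superset (hR ha) (entourage_mono (le_max_left _ _))⟩

/-- A bounded kernel supported in an entourage extends to the coarse groupoid. -/
theorem exists_extension_kernel (k : X → X → ℂ) {M R : ℝ} (hR : 0 < R)
    (hM : ∀ x y, ‖k x y‖ ≤ M) (hk : ∀ x y, k x y ≠ 0 → dist x y ≤ R) :
    ∃ f : C_c(CoarseArrow X, ℂ), ∀ x y, f (pair x y) = k x y := by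
  have : CompactSpace (Metric.closedBall (0 : ℂ) M) :=
    isCompact_iff_compactSpace.1 (isCompact_closedBall _ _)
  -- With values in a compact disc, the kernel extends along the universal property of the
  -- Stone-Čech compactification.
  let k' : X × X → Metric.closedBall (0 : ℂ) M := fun p => ⟨k p.1 p.2, by simpa using hM _ _⟩
  let F : CoarseArrow X → ℂ := fun a => (Ultrafilter.extend k' a.1).1
  have hF : Continuous F :=
    continuous_subtype_val.comp ((continuous_ultrafilter_extend k').comp continuous_subtype_val)
  have hFp : ∀ x y, F (pair x y) = k x y := fun x y =>
    congrArg Subtype.val (congrFun (ultrafilter_extend_extends k') (x, y))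
  refine ⟨⟨⟨F, hF⟩, HasCompactSupport.intro (isCompact_mem_entourage hR) fun a ha => ?_⟩, hFp⟩
  refine tendsto_nhds_unique ((hF.tendsto a).comp (tendsto_pair a)) ?_
  refine tendsto_const_nhds.congr' ?_
  filter_upwards [Ultrafilter.compl_mem_iff_notMem.2 ha] with p hp
  change 0 = F (pair p.1 p.2)
  rw [hFp]
  by_contra h
  exact hp (hk _ _ (Ne.symm h))

theorem src_pair (x y : X) : src (pair x y) = pure y := Ultrafilter.map_pure _ _

theorem rng_pair (x y : X) : rng (pair x y) = pure x := Ultrafilter.map_pure _ _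

variable [BoundedGeometry X]

/-- The support of `f` lies in the compact open closure of one entourage. Tietze extension from the
part of it over `Y` takes place in all ultrafilters on `X × X`, a compact Hausdorff and hence normal
space; the indicator of the clopen set then restores compact support without losing continuity. -/
theorem restrictCc_surjective {Y : Set (Ultrafilter X)} (hc : IsClosed Y) :
    Function.Surjective ((coarseGroupoid X).restrictCc Y hc) := by
  classical
  intro f
  have hcs : Continuous (src : CoarseArrow X → Ultrafilter X) := (coarseGroupoid X).continuous_src
  obtain ⟨R, hR, hf⟩ :=
    exists_entourage_of_isCompact (f.hasCompactSupport.isCompact.image continuous_subtype_val)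
  set s : Set (CoarseArrow X) := {a | entourage X R ∈ a.1 ∧ src a ∈ Y}
  have hs : IsCompact s := (isCompact_mem_entourage hR).inter_right (hc.preimage hcs)
  have : CompactSpace s := isCompact_iff_compactSpace.1 hs
  let e : s → Ultrafilter (X × X) := fun a => a.1.1
  have he : Continuous e := continuous_subtype_val.comp continuous_subtype_val
  have hemb : Topology.IsClosedEmbedding e :=
    he.isClosedEmbedding (Subtype.val_injective.comp Subtype.val_injective)
  let f' : C(s, ℂ) := ⟨fun a => f ⟨a.1, a.2.2⟩, f.continuous.comp (by
    exact Continuous.subtype_mk continuous_subtype_val _)⟩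
  obtain ⟨g, hg⟩ := ContinuousMap.exists_extension' hemb f'
  have hcl : IsClopen {a : CoarseArrow X | entourage X R ∈ a.1} := ⟨isClosed_mem _, isOpen_mem _⟩
  let F : CoarseArrow X → ℂ :=
    Set.indicator {a : CoarseArrow X | entourage X R ∈ a.1} fun a => g a.1
  have hF : Continuous F :=
    (g.continuous.comp continuous_subtype_val).indicator fun a ha => by
      rw [hcl.frontier_eq] at ha
      exact ha.elim
  have hF0 : ∀ a : CoarseArrow X, entourage X R ∉ a.1 → F a = 0 := fun a ha =>
    Set.indicator_of_notMem (s := {a : CoarseArrow X | entourage X R ∈ a.1}) ha _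
  refine ⟨⟨⟨F, hF⟩, HasCompactSupport.intro (isCompact_mem_entourage hR) hF0⟩, ?_⟩
  ext a
  change F a.1 = f a
  by_cases ha : entourage X R ∈ a.1.1
  · exact (Set.indicator_of_mem (s := {a : CoarseArrow X | entourage X R ∈ a.1}) ha _).trans
      (congrFun hg ⟨a.1, ha, a.2⟩)
  · rw [hF0 _ ha]
    by_contra h
    exact ha (hf _ ⟨a, subset_tsupport _ (Ne.symm h), rfl⟩)

/-- An arrow is the image of its source under some graph map `y ↦ (t y, y)`, so a principal source
forces a principal arrow. -/
theorem exists_eq_pair {a : CoarseArrow X} {y : X} (h : src a = pure y) : ∃ x, pair x y = a := by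
  obtain ⟨A, hA, -, hAi⟩ := exists_injOn a
  obtain ⟨t, -, ht⟩ := exists_graph hAi
  refine ⟨t y, Subtype.ext ?_⟩
  rw [← ht a.1 hA]
  change _ = (src a).map _
  rw [h, Ultrafilter.map_pure]
  rfl

/-- The arrows with source a given point of `X`, indexed by their ranges. -/
def fibre (y : X) : X ↪ CoarseArrow X where
  toFun x := pair x y
  inj' x x' h := by
    have := congrArg rng h
    rw [rng_pair, rng_pair] at this
    exact Ultrafilter.pure_injective this

end CoarseArrow

/-! ### The canonical isomorphism with the uniform Roe algebra. -/

section Iso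

open CoarseArrow

variable {X : Type*} [MetricSpace X] [BoundedGeometry X]

theorem symb_eq_zero_of_pair {T : BOp (CoarseArrow X)} (hT : T ∈ (coarseGroupoid X).reducedCStar)
    (h : ∀ x y, (coarseGroupoid X).symb T (pair x y) = 0) : (coarseGroupoid X).symb T = 0 := by
  ext a
  refine tendsto_nhds_unique
    ((((coarseGroupoid X).continuous_symb hT).tendsto a).comp (tendsto_pair a)) ?_
  exact tendsto_const_nhds.congr fun p => (h _ _).symm

/-- The quotient of `pair x z` by `pair y z` has the range and source of `pair x y`, hence equals
it. The matrix on the fibre over `z` is therefore independent of `z`. -/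
theorem coeff_pair {T : BOp (CoarseArrow X)} (hT : T ∈ (coarseGroupoid X).reducedCStar)
    (x y z : X) :
    coeff T (pair x z) (pair y z) = (coarseGroupoid X).symb T (pair x y) := by
  have h : (coarseGroupoid X).src (pair x z) = (coarseGroupoid X).src (pair y z) :=
    (src_pair x z).trans (src_pair y z).symm
  rw [(coarseGroupoid X).coeff_eq_kern_symb hT, (coarseGroupoid X).kern_of_eq _ h]
  refine congrArg _ (ext_src_rng ?_ ?_)
  · exact ((coarseGroupoid X).src_div _ _ h).trans ((rng_pair y z).trans (src_pair x y).symm)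
  · exact ((coarseGroupoid X).rng_div _ _ h).trans ((rng_pair x z).trans (rng_pair x y).symm)

/-- The regular representation on the arrows with source a given point of `X`. -/
def fibreRep (z : X) : (coarseGroupoid X).reducedCStar →⋆ₙₐ[ℂ] BOp X where
  toFun T := pullbackOp (fibre z) T
  map_smul' c T := op_ext fun x y => by
    change coeff (pullbackOp _ (c • (T : BOp (CoarseArrow X)))) x y = coeff (c • pullbackOp _ _) x y
    simp only [coeff_pullbackOp, coeff_smul]
  map_zero' := op_ext fun x y => by
    change coeff (pullbackOp _ 0) x y = 0
    simp only [coeff_pullbackOp, coeff_zero]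
  map_add' T S := op_ext fun x y => by
    change coeff (pullbackOp _ ((T : BOp (CoarseArrow X)) + (S : BOp (CoarseArrow X)))) x y =
      coeff (pullbackOp _ _ + pullbackOp _ _) x y
    simp only [coeff_pullbackOp, coeff_add]
  -- A nonzero coefficient forces `b` to have source `pure z`, and such an arrow is a pair in the
  -- fibre.
  map_mul' T S := pullbackOp_mul (fibre z) (fun x b hb => by
    rw [(coarseGroupoid X).coeff_eq_kern_symb T.2]
    refine (coarseGroupoid X).kern_of_ne _ fun h => hb ?_
    exact exists_eq_pair (h.symm.trans (src_pair x z))) S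
  map_star' T := op_ext fun x y => by
    change coeff (pullbackOp _ (star (T : BOp (CoarseArrow X)))) x y =
      coeff (star (pullbackOp _ _)) x y
    simp only [coeff_pullbackOp, coeff_star]

theorem coeff_fibreRep (z : X) (T : (coarseGroupoid X).reducedCStar) (x y : X) :
    coeff (fibreRep z T) x y = (coarseGroupoid X).symb (T : BOp (CoarseArrow X)) (pair x y) :=
  (coeff_pullbackOp _ _ x y).trans (coeff_pair T.2 x y z)

variable (X) in
theorem exists_rep : ∃ φ : (coarseGroupoid X).reducedCStar →⋆ₙₐ[ℂ] BOp X, ∀ T x y,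
    coeff (φ T) x y = (coarseGroupoid X).symb (T : BOp (CoarseArrow X)) (pair x y) := by
  rcases isEmpty_or_nonempty X with h | ⟨⟨z⟩⟩
  -- An empty `X` offers no base point for a fibre, but then there are no coefficients to match
  -- either.
  · exact ⟨0, fun T x => h.elim x⟩
  · exact ⟨fibreRep z, coeff_fibreRep z⟩

instance isClosed_uniformRoe : IsClosed (uniformRoe X : Set (BOp X)) :=
  StarSubalgebra.isClosed_topologicalClosure _

theorem range_rep (φ : (coarseGroupoid X).reducedCStar →⋆ₙₐ[ℂ] BOp X)
    (hφ : ∀ T x y,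
      coeff (φ T) x y = (coarseGroupoid X).symb (T : BOp (CoarseArrow X)) (pair x y)) :
    Set.range φ = (uniformRoe X : Set (BOp X)) := by
  have hreg : ∀ (f : C_c(CoarseArrow X, ℂ)) x y,
      coeff (φ ((coarseGroupoid X).ofCc f)) x y = f (pair x y) := fun f x y => by
    rw [hφ]
    exact congrFun ((coarseGroupoid X).symb_reg f) _
  have hcont : Continuous φ :=
    AddMonoidHomClass.continuous_of_bound φ 1 fun a => by
      rw [one_mul]
      exact NonUnitalStarAlgHom.norm_apply_le φ a
  refine subset_antisymm ?_ (closure_minimal ?_ (isClosed_range_starHom φ))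
  · rintro _ ⟨T, rfl⟩
    refine map_mem_closure hcont ((coarseGroupoid X).dense_range_ofCc T) ?_
    rintro _ ⟨f, rfl⟩
    obtain ⟨R, hR, h⟩ := exists_entourage_of_isCompact f.hasCompactSupport.isCompact
    refine ⟨R, fun x y hxy => h (pair x y) (subset_tsupport _ ?_)⟩
    rwa [hreg] at hxy
  · rintro S ⟨R, hS⟩
    -- The entries of `S` are bounded by `‖S‖`, so finite propagation alone makes its matrix a
    -- function in the convolution algebra. The maximum with 1 only secures a positive radius.
    obtain ⟨f, hf⟩ := exists_extension_kernel (coeff S) (R := max R 1) (by positivity)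
      (norm_coeff_le S) fun x y h => (hS x y h).trans (le_max_left _ _)
    exact ⟨(coarseGroupoid X).ofCc f, op_ext fun x y => by rw [hreg, hf]⟩

variable (X) in
-- Injectivity is the density of the pairs: if the image of `T` is zero, then `symb T` vanishes at
-- all pairs, hence everywhere, and `T = 0`.
theorem exists_extendsCanonical :
    ∃ Θ : (coarseGroupoid X).reducedCStar ≃⋆ₐ[ℂ] uniformRoe X, ExtendsCanonical Θ := by
  obtain ⟨φ, hφ⟩ := exists_rep X
  have hr := range_rep φ hφ
  let ψ : (coarseGroupoid X).reducedCStar →⋆ₙₐ[ℂ] uniformRoe X :=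
    { toFun := fun T => ⟨φ T, hr.subset (Set.mem_range_self T)⟩
      map_smul' := fun c T => Subtype.ext (map_smul φ c T)
      map_zero' := Subtype.ext (map_zero φ)
      map_add' := fun T S => Subtype.ext (map_add φ T S)
      map_mul' := fun T S => Subtype.ext (map_mul φ T S)
      map_star' := fun T => Subtype.ext (map_star φ T) }
  have hψ : Function.Bijective ψ := by
    refine ⟨(injective_iff_map_eq_zero ψ).2 fun T hT => ?_, fun S => ?_⟩
    · have h0 : φ T = 0 := congrArg Subtype.val hT
      refine Subtype.ext ((coarseGroupoid X).eq_zero_of_symb_eq_zero T.2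
        (symb_eq_zero_of_pair T.2 fun x y => ?_))
      rw [← hφ, h0, coeff_zero]
    · obtain ⟨T, hT⟩ : (S : BOp X) ∈ Set.range φ := hr.symm ▸ S.2
      exact ⟨T, Subtype.ext hT⟩
  refine ⟨StarAlgEquiv.ofBijective ψ hψ, fun f x y => ?_⟩
  change coeff (φ _) x y = _
  rw [hφ]
  exact congrFun ((coarseGroupoid X).symb_reg f) _

/-- A star isomorphism between C*-algebras is isometric, so both sides are continuous in `T` and it
suffices to compare them on the convolution algebra. Uniqueness of `Θ` follows at once. -/
theorem ExtendsCanonical.coeff_eq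
    {Θ : (coarseGroupoid X).reducedCStar ≃⋆ₐ[ℂ] uniformRoe X} (hΘ : ExtendsCanonical Θ)
    (T : (coarseGroupoid X).reducedCStar) (x y : X) :
    coeff (Θ T : BOp X) x y = (coarseGroupoid X).symb (T : BOp (CoarseArrow X)) (pair x y) := by
  have h1 : Continuous fun T => coeff (Θ T : BOp X) x y :=
    (continuous_coeff x y).comp (continuous_subtype_val.comp (StarAlgEquiv.isometry Θ).continuous)
  have h2 : Continuous fun T : (coarseGroupoid X).reducedCStar =>
      (coarseGroupoid X).symb (T : BOp (CoarseArrow X)) (pair x y) :=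
    ((coarseGroupoid X).continuous_symb_apply _).comp continuous_subtype_val
  refine congrFun ((coarseGroupoid X).dense_range_ofCc.equalizer h1 h2 (funext fun f => ?_)) T
  exact (hΘ f x y).trans (congrFun ((coarseGroupoid X).symb_reg f) _).symm

theorem ExtendsCanonical.eq
    {Θ Θ' : (coarseGroupoid X).reducedCStar ≃⋆ₐ[ℂ] uniformRoe X} (hΘ : ExtendsCanonical Θ)
    (hΘ' : ExtendsCanonical Θ') : Θ = Θ' := by
  ext1 T
  exact Subtype.ext (op_ext fun x y => by rw [hΘ.coeff_eq, hΘ'.coeff_eq])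

/-! ### The kernel of `q_U` and the range of `i_U` inside the uniform Roe algebra. -/

theorem exists_entourage_of_le_norm_symb {T : BOp (CoarseArrow X)}
    (hT : T ∈ (coarseGroupoid X).reducedCStar) {ε : ℝ} (hε : 0 < ε) :
    ∃ R > 0, ∀ a, ε ≤ ‖(coarseGroupoid X).symb T a‖ → entourage X R ∈ a.1 := by
  obtain ⟨f, hf⟩ := (coarseGroupoid X).exists_norm_sub_reg_lt hT hε
  obtain ⟨R, hR, h⟩ := exists_entourage_of_isCompact f.hasCompactSupport.isCompact
  -- Since `f` is closer to `symb T` than `ε`, it cannot vanish where `symb T` has absolute value at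
  -- least `ε`.
  refine ⟨R, hR, fun a ha => h a (subset_tsupport _ fun h0 => ?_)⟩
  have := (coarseGroupoid X).norm_symb_sub_le T ((coarseGroupoid X).reg f) a
  rw [(coarseGroupoid X).symb_reg, h0, sub_zero] at this
  linarith

theorem ExtendsCanonical.mem_ghostlyIdeal_iff
    {Θ : (coarseGroupoid X).reducedCStar ≃⋆ₐ[ℂ] uniformRoe X} (hΘ : ExtendsCanonical Θ)
    {U : Set (Ultrafilter X)} (hinv : (coarseGroupoid X).IsInvariant U)
    (T : (coarseGroupoid X).reducedCStar) :
    Θ T ∈ ghostlyIdeal U ↔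
      ∀ a, src a ∈ Uᶜ → (coarseGroupoid X).symb (T : BOp (CoarseArrow X)) a = 0 := by
  have hcont := (coarseGroupoid X).continuous_symb T.2
  have hinv' : ∀ a : CoarseArrow X, rng a ∈ U ↔ src a ∈ U := hinv.mem_iff
  simp only [ghostlyIdeal, Set.mem_ofPred_eq, closure_image_pure, hΘ.coeff_eq]
  constructor
  · intro h a ha
    by_contra hne
    have hpos : 0 < ‖(coarseGroupoid X).symb (T : BOp (CoarseArrow X)) a‖ := norm_pos_iff.2 hne
    -- At half the value of `‖symb T a‖`, the pairs exceeding the level form a set in the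
    -- ultrafilter `a`. Their first coordinates then form a set in `rng a`, so `rng a`, and by
    -- invariance `src a`, lies in `U`.
    refine ha ((hinv' a).1 (h _ (half_pos hpos) ?_))
    have hev := ((hcont.norm.tendsto a).comp (tendsto_pair a)).eventually
      (lt_mem_nhds (half_lt_self hpos))
    change Prod.fst ⁻¹' _ ∈ a.1
    exact Filter.mem_of_superset hev fun p hp => ⟨p.2, le_of_lt hp⟩
  · intro h ε hε u hu
    obtain ⟨R, hR, hE⟩ := exists_entourage_of_le_norm_symb T.2 hε
    have ht : ∀ x, ∃ y, x ∈ {x | ∃ y, ε ≤ ‖(coarseGroupoid X).symb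
        (T : BOp (CoarseArrow X)) (pair x y)‖} →
        ε ≤ ‖(coarseGroupoid X).symb (T : BOp (CoarseArrow X)) (pair x y)‖ := fun x => by
      by_cases hx : x ∈ {x | ∃ y, ε ≤ ‖(coarseGroupoid X).symb
        (T : BOp (CoarseArrow X)) (pair x y)‖}
      · obtain ⟨y, hy⟩ := hx
        exact ⟨y, fun _ => hy⟩
      -- The value `t x = x` is a mere default: the set of these `x` is not in `u`.
      · exact ⟨x, fun h => absurd h hx⟩
    choose t ht using ht
    -- The large entries of `T` all lie in one entourage, so pushing `u` forward to the graph of `t`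
    -- gives an arrow of the coarse groupoid with range `u`. By continuity `‖symb T‖` is still at
    -- least `ε` there.
    let a : CoarseArrow X := ⟨u.map fun x => (x, t x), mem_coarseArrows.2 ⟨R, hR,
      Ultrafilter.mem_map.2 (Filter.mem_of_superset hu fun x hx => hE _ (ht x hx))⟩⟩
    have hr : rng a = u := (Ultrafilter.map_map _ _ _).trans (Ultrafilter.map_id _)
    rw [← hr, hinv']
    by_contra hs
    have hlim := (hcont.norm.tendsto a).comp (tendsto_pair a)
    have : ε ≤ ‖(coarseGroupoid X).symb (T : BOp (CoarseArrow X)) a‖ :=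
      ge_of_tendsto hlim (show ∀ᶠ x in u, ε ≤ ‖(coarseGroupoid X).symb
        (T : BOp (CoarseArrow X)) (pair x (t x))‖ from Filter.mem_of_superset hu ht)
    rw [h a hs, norm_zero] at this
    linarith

theorem ExtendsCanonical.image_ker
    {Θ : (coarseGroupoid X).reducedCStar ≃⋆ₐ[ℂ] uniformRoe X} (hΘ : ExtendsCanonical Θ)
    {U : Set (Ultrafilter X)} (hU : IsOpen U) (hinv : (coarseGroupoid X).IsInvariant U) :
    Θ '' {a | (coarseGroupoid X).restrictionHom Uᶜ hinv.compl hU.isClosed_compl a = 0} =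
      ghostlyIdeal U := by
  ext S
  obtain ⟨T, rfl⟩ := EquivLike.surjective Θ S
  rw [(EquivLike.injective Θ).mem_set_image, hΘ.mem_ghostlyIdeal_iff hinv]
  exact (coarseGroupoid X).restrictionHom_eq_zero_iff _ _ _ T

theorem ExtendsCanonical.image_range
    {Θ : (coarseGroupoid X).reducedCStar ≃⋆ₐ[ℂ] uniformRoe X} (hΘ : ExtendsCanonical Θ)
    {U : Set (Ultrafilter X)} (hU : IsOpen U) (hinv : (coarseGroupoid X).IsInvariant U) :
    Θ '' Set.range ((coarseGroupoid X).inclusionHom U hinv hU) = geometricIdeal U := by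
  -- As an isometry of complete spaces, `Θ` commutes with closures; it remains to match the
  -- generating sets before closure.
  have hcl : Topology.IsClosedEmbedding Θ := (StarAlgEquiv.isometry Θ).isClosedEmbedding
  rw [(coarseGroupoid X).range_inclusionHom, (coarseGroupoid X).closure_range_extendCc, ← hcl.closure_image_eq, geometricIdeal]
  congr 1
  ext S
  constructor
  · rintro ⟨_, ⟨f, hf, rfl⟩, rfl⟩
    exact ⟨f, hf, hΘ f⟩
  · rintro ⟨f, hf, hS⟩
    refine ⟨_, ⟨f, hf, rfl⟩, Subtype.ext (op_ext fun x y => ?_)⟩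
    rw [hΘ, hS]

end Iso

end CoarseIdeals

end

/-! ### The main theorem. -/

theorem mainTheorem7 {X : Type*} [MetricSpace X] [BoundedGeometry X]
    (U : Set (Ultrafilter X)) (hU : IsOpen U) (hinv : (coarseGroupoid X).IsInvariant U) :
    (∃! Θ : (coarseGroupoid X).reducedCStar ≃⋆ₐ[ℂ] uniformRoe X, ExtendsCanonical Θ) ∧
    (∀ Θ : (coarseGroupoid X).reducedCStar ≃⋆ₐ[ℂ] uniformRoe X, ExtendsCanonical Θ →
      Θ '' {a | (coarseGroupoid X).restrictionHom Uᶜ hinv.compl hU.isClosed_compl a = 0} =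
        ghostlyIdeal U) ∧
    ((Function.Injective ((coarseGroupoid X).inclusionHom U hinv hU) ∧
        Function.Exact ((coarseGroupoid X).inclusionHom U hinv hU)
          ((coarseGroupoid X).restrictionHom Uᶜ hinv.compl hU.isClosed_compl) ∧
        Function.Surjective
          ((coarseGroupoid X).restrictionHom Uᶜ hinv.compl hU.isClosed_compl)) ↔
      geometricIdeal U = ghostlyIdeal U) := by
  obtain ⟨Θ, hΘ⟩ := exists_extendsCanonical X
  refine ⟨⟨Θ, hΘ, fun Θ' hΘ' => hΘ'.eq hΘ⟩, fun Θ' hΘ' => hΘ'.image_ker hU hinv, ?_⟩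
  -- Both ideals are images under the injective map `Θ`, so their equality becomes the equality of
  -- the range of `i_U` and the kernel of `q_U`, which is exactness in the middle.
  rw [← hΘ.image_ker hU hinv, ← hΘ.image_range hU hinv, (EquivLike.injective Θ).image_injective.eq_iff]
  constructor
  · rintro ⟨-, h, -⟩
    ext T
    exact (h T).symm
  · intro h
    refine ⟨(coarseGroupoid X).inclusionHom_injective U hinv hU, fun T => ?_,
      (coarseGroupoid X).restrictionHom_surjective _ _ _ (CoarseArrow.restrictCc_surjective _)⟩
    rw [h]
    rfl
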